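/- **Theorem (upper bounds for the regularized LSE).** Let $\{\boldsymbol r_t\}_{t\in\mathbb Z}$ be an $N$-dimensional BEKK-ARCH process of order $p\ge 1$, $$\boldsymbol r_t=\boldsymbol\Sigma_t^{1/2}\boldsymbol\eta_t,\qquad \boldsymbol\Sigma_t=\boldsymbol\Omega+\sum_{i=1}^p\sum_{k=1}^{K_i}\mathbf A_{ik}\boldsymbol r_{t-i}\boldsymbol r_{t-i}^{\mathrm T}\mathbf A_{ik}^{\mathrm T},$$ where $N\ge 1$, $\boldsymbol\Omega$ is positive definite and $\{\boldsymbol\eta_t\}$ are i.i.d. with mean zero and identity covariance, $\boldsymbol\eta_t$ being independent of $\sigma(\boldsymbol r_{t-1},\boldsymbol r_{t-2},\dots)$. Put $d=N(N+1)/2$, $\boldsymbol y_t=\operatorname{vech}(\boldsymbol r_t\boldsymbol r_t^{\mathrm T})\in\mathbb R^d$, $\boldsymbol x_t=(1,\boldsymbol y_{t-1}^{\mathrm T},\dots,\boldsymbol y_{t-p}^{\mathrm T})^{\mathrm T}\in\mathbb R^{pd+1}$, $\boldsymbol\Gamma_x=\mathbb E(\boldsymbol x_t\boldsymbol x_t^{\mathrm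 T})$, and $\boldsymbol\Theta^*=(\operatorname{vech}(\boldsymbol\Omega),\boldsymbol\Phi_1,\dots,\boldsymbol\Phi_p)^{\mathrm T}\in\mathbb R^{(pd+1)\times d}$ with $\boldsymbol\Phi_i=\mathbf D_N^\dagger\bigl(\sum_{k}\mathbf A_{ik}\otimes\mathbf A_{ik}\bigr)\mathbf D_N$, where $\mathbf D_N$ is the duplication matrix and $\mathbf D_N^\dagger=(\mathbf D_N^{\mathrm T}\mathbf D_N)^{-1}\mathbf D_N^{\mathrm T}$. For a matrix $\mathbf B$ let $\|\mathbf B\|_{1,1}=\sum_{i,j}|b_{ij}|$, let $\|\mathbf B\|_{1,\infty}$ and $\|\mathbf B\|_{2,\infty}$ be the largest $\ell_1$- and $\ell_2$-norm of a column, and let $\|\mathbf B\|_{\mathrm F}$ be the Frobenius norm. For $\tau>0$ let $\boldsymbol r_t(\tau)$ have entries $\operatorname{sign}(r_{t,j})\min\{|r_{t,j}|,\tau\}$, let $\boldsymbol y_t(\tau),\boldsymbol x_t(\tau)$ be formed from $\boldsymbol r_t(\tau)$ as above, and let $\mathbf Y(\tau),\mathbf X(\tau)$ have rows $\boldsymbol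 y_t(\tau)^{\mathrm T},\boldsymbol x_t(\tau)^{\mathrm T}$, $t=1,\dots,T$. Let $\widehat{\boldsymbol\Theta}$ be any minimizer of $\frac1{2T}\|\mathbf Y(\tau)-\mathbf X(\tau)\boldsymbol\Theta\|_{\mathrm F}^2+\lambda\|\boldsymbol\Theta\|_{1,1}$ over $\boldsymbol\Theta\in\mathbb R^{(pd+1)\times d}$. Assume that $\{\boldsymbol r_t\}$ is strictly stationary; that for some $\epsilon\in(0,1]$, $\mathbb E|r_{t,j}|^{4+4\epsilon}\le M_{4+4\epsilon}<\infty$ for all $j$; that its $\alpha$-mixing coefficients satisfy $\alpha(\ell)\le C_\alpha\zeta^\ell$ for $\ell\ge 1$, with $0\le\zeta\le\bar\zeta<1$; that $\boldsymbol\Gamma_x$ is positive definite, with smallest eigenvalue $\lambda_{\min}(\boldsymbol\Gamma_x)$; that every column of $\boldsymbol\Theta^*$ has at most $s$ nonzero entries; and that $\|\boldsymbol\Theta^*\|_{1,\infty}\ge\theta_0>0$. Put $M=\max\{M_{4+4\epsilon},1\}$, $T_{\mathrm{eff}}=T/(\log T)^2$ with $T\ge2$, and $$R=\Bigl(\frac{M^{1/\epsilon}\log(pd+1)}{T_{\mathrm{eff}}}\Bigr)^{\frac{\epsilon}{1+\epsilon}}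 .$$ Suppose $T\ge c_T\log(pd+1)$ and $c_\tau\le\tau\big/\bigl(\tfrac{M T_{\mathrm{eff}}}{\log(pd+1)}\bigr)^{1/(4+4\epsilon)}\le C_\tau$, for any fixed constants $c_T>0$ and $0<c_\tau\le C_\tau$. Then there is a constant $c_\lambda>0$, depending only on $p,\epsilon,\bar\zeta,C_\alpha,c_T,c_\tau,C_\tau,\theta_0$, and for every $C_\lambda\ge c_\lambda$ there are constants $C_0,C_1,c_2>0$, depending only on these and $C_\lambda$ (not on $N,T,s,M$ or on the process), such that, whenever $$c_\lambda\, s\|\boldsymbol\Theta^*\|_{1,\infty}R\le\lambda\le C_\lambda\, s\|\boldsymbol\Theta^*\|_{1,\infty}R,$$ with probability at least $1-C_1\exp[-c_2\,s\log(T)\log(pd+1)]$ both $$\|\widehat{\boldsymbol\Theta}-\boldsymbol\Theta^*\|_{2,\infty}\le C_0\,s^{3/2}\|\boldsymbol\Theta^*\|_{1,\infty}\lambda_{\min}^{-1}(\boldsymbol\Gamma_x)\,R\quad\text{and}\quad\|\widehat{\boldsymbol\Theta}-\boldsymbol\Theta^*\|_{\mathrm F}\le C_0\,s^{3/2}N\|\boldsymbol\Theta^*\|_{1,\infty}\lambda_{\min}^{-1}(\boldsymbol\Gamma_x)\,R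 .$$ -/

import Mathlib

open MeasureTheory ProbabilityTheory
open scoped Matrix Kronecker

noncomputable section

namespace BEKK

/-! ### Half-vectorization, duplication matrix -/

/-- Positions on or below the diagonal of an `N × N` matrix: the index set of `vech`. -/
abbrev VechIdx (N : ℕ) : Type := {q : Fin N × Fin N // q.2 ≤ q.1}

/-- `d = N (N + 1) / 2`. -/
def vechDim (N : ℕ) : ℕ := N * (N + 1) / 2

/-- Half-vectorization of a square matrix. -/
def vech {N : ℕ} (B : Matrix (Fin N) (Fin N) ℝ) : VechIdx N → ℝ :=
  fun q => B q.1.1 q.1.2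

/-- The duplication matrix `D_N`, with `D_N vech(B) = vec(B)` for symmetric `B`; the rows are indexed
by the positions `(i, j)` of an `N × N` matrix. -/
def dupMatrix (N : ℕ) : Matrix (Fin N × Fin N) (VechIdx N) ℝ :=
  fun a q => if a = q.1 ∨ a.swap = q.1 then 1 else 0

/-- The elimination matrix `D_N^† = (D_Nᵀ D_N)⁻¹ D_Nᵀ`. -/
def elimMatrix (N : ℕ) : Matrix (VechIdx N) (Fin N × Fin N) ℝ :=
  ((dupMatrix N)ᵀ * dupMatrix N)⁻¹ * (dupMatrix N)ᵀ

/-! ### The BEKK-ARCH model -/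

/-- The σ-algebra generated by `r_u`, `u ≤ t`. -/
abbrev pastSigma {Ω E : Type*} [MeasurableSpace E] (r : ℤ → Ω → E) (t : ℤ) : MeasurableSpace Ω :=
  ⨆ u : {u : ℤ // u ≤ t}, MeasurableSpace.comap (r u) inferInstance

/-- The σ-algebra generated by `r_u`, `u ≥ t`. -/
abbrev futureSigma {Ω E : Type*} [MeasurableSpace E] (r : ℤ → Ω → E) (t : ℤ) : MeasurableSpace Ω :=
  ⨆ u : {u : ℤ // t ≤ u}, MeasurableSpace.comap (r u) inferInstance

/-- `Σ_t = Om + ∑_i ∑_k A_{ik} r_{t-i} r_{t-i}ᵀ A_{ik}ᵀ` along a path; the `i`-th lag, `1 ≤ i ≤ p`, is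
coded by `i - 1 : Fin p`. -/
def condCov {N p : ℕ} {K : Fin p → ℕ} (Om : Matrix (Fin N) (Fin N) ℝ)
    (A : (i : Fin p) → Fin (K i) → Matrix (Fin N) (Fin N) ℝ) (path : ℤ → Fin N → ℝ) (t : ℤ) :
    Matrix (Fin N) (Fin N) ℝ :=
  Om + ∑ i : Fin p, ∑ k : Fin (K i),
    A i k * Matrix.vecMulVec (path (t - ((i : ℕ) + 1))) (path (t - ((i : ℕ) + 1))) * (A i k)ᵀ

/-- `r` is a BEKK-ARCH process of order `p` with innovations `η` and parameters `Om`, `A`. -/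
structure IsBEKKARCH {Ω : Type*} [MeasurableSpace Ω] (μ : Measure Ω) {N p : ℕ} {K : Fin p → ℕ}
    (Om : Matrix (Fin N) (Fin N) ℝ) (A : (i : Fin p) → Fin (K i) → Matrix (Fin N) (Fin N) ℝ)
    (r η : ℤ → Ω → Fin N → ℝ) : Prop where
  measurable_r : ∀ t, Measurable (r t)
  measurable_η : ∀ t, Measurable (η t)
  posDef : Om.PosDef
  /-- the innovations are i.i.d. … -/
  iIndep : iIndepFun η μ
  ident : ∀ t, IdentDistrib (η t) (η 0) μ μ
  /-- … with mean zero and identity covariance … -/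
  memLp : ∀ t i, MemLp (fun ω => η t ω i) 2 μ
  mean : ∀ t i, ∫ ω, η t ω i ∂μ = 0
  cov : ∀ t i j, ∫ ω, η t ω i * η t ω j ∂μ = if i = j then 1 else 0
  /-- … and `η_t` is independent of `r_{t-1}, r_{t-2}, …`. -/
  indep_past : ∀ t, Indep (MeasurableSpace.comap (η t) inferInstance) (pastSigma r (t - 1)) μ
  /-- `r_t = Σ_t^{1/2} η_t`, where `Σ_t^{1/2}` is the positive semidefinite square root. -/
  eqn : ∀ t, ∀ᵐ ω ∂μ, ∃ S : Matrix (Fin N) (Fin N) ℝ, S.PosSemidef ∧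
    S * S = condCov Om A (fun u => r u ω) t ∧ r t ω = S *ᵥ η t ω

/-- Strict stationarity. -/
def StrictlyStationary {Ω E : Type*} [MeasurableSpace Ω] [MeasurableSpace E] (μ : Measure Ω)
    (r : ℤ → Ω → E) : Prop :=
  ∀ h : ℤ, IdentDistrib (fun ω t => r (t + h) ω) (fun ω t => r t ω) μ μ

/-- The α-mixing coefficient `α(ℓ)`. -/
def alphaMixing {Ω E : Type*} [MeasurableSpace Ω] [MeasurableSpace E] (μ : Measure Ω)
    (r : ℤ → Ω → E) (l : ℕ) : ℝ :=
  sSup {a : ℝ | ∃ (t : ℤ) (A B : Set Ω), MeasurableSet[pastSigma r t] A ∧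
    MeasurableSet[futureSigma r (t + l)] B ∧ a = |μ.real (A ∩ B) - μ.real A * μ.real B|}

/-! ### The VAR form and the estimator -/

/-- Index set of the rows of `Θ` (intercept, then lag and coordinate); it has `p d + 1` elements. -/
abbrev RegIdx (N p : ℕ) : Type := Option (Fin p × VechIdx N)

/-- `y_t = vech(r_t r_tᵀ)` along a path. -/
def yVec {N : ℕ} (path : ℤ → Fin N → ℝ) (t : ℤ) : VechIdx N → ℝ :=
  vech (Matrix.vecMulVec (path t) (path t))

/-- `x_t = (1, y_{t-1}ᵀ, …, y_{t-p}ᵀ)ᵀ` along a path. -/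
def xVec {N : ℕ} (p : ℕ) (path : ℤ → Fin N → ℝ) (t : ℤ) : RegIdx N p → ℝ
  | none => 1
  | some (i, q) => yVec path (t - ((i : ℕ) + 1)) q

/-- `Φ_i = D_N^† (∑_k A_{ik} ⊗ A_{ik}) D_N`. -/
def Phi {N p : ℕ} {K : Fin p → ℕ} (A : (i : Fin p) → Fin (K i) → Matrix (Fin N) (Fin N) ℝ)
    (i : Fin p) : Matrix (VechIdx N) (VechIdx N) ℝ :=
  elimMatrix N * (∑ k : Fin (K i), A i k ⊗ₖ A i k) * dupMatrix N

/-- The true coefficient matrix `Θ* = (vech(Om), Φ_1, …, Φ_p)ᵀ`. -/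
def thetaStar {N p : ℕ} {K : Fin p → ℕ} (Om : Matrix (Fin N) (Fin N) ℝ)
    (A : (i : Fin p) → Fin (K i) → Matrix (Fin N) (Fin N) ℝ) :
    Matrix (RegIdx N p) (VechIdx N) ℝ
  | none, j => vech Om j
  | some (i, q), j => Phi A i j q

/-- `‖Θ‖_{1,1}`. -/
def norm11 {m n : Type*} [Fintype m] [Fintype n] (B : Matrix m n ℝ) : ℝ := ∑ j, ∑ i, |B i j|

/-- `‖Θ‖_{1,∞}`: the largest `ℓ₁`-norm of a column. -/
def norm1Inf {m n : Type*} [Fintype m] (B : Matrix m n ℝ) : ℝ := ⨆ j, ∑ i, |B i j|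

/-- `‖Θ‖_{2,∞}`: the largest Euclidean norm of a column. -/
def norm2Inf {m n : Type*} [Fintype m] (B : Matrix m n ℝ) : ℝ := ⨆ j, √(∑ i, B i j ^ 2)

/-- The Frobenius norm. -/
def normF {m n : Type*} [Fintype m] [Fintype n] (B : Matrix m n ℝ) : ℝ := √(∑ i, ∑ j, B i j ^ 2)

/-- Element-wise truncation of a path at level `τ`. -/
def truncPath {N : ℕ} (τ : ℝ) (path : ℤ → Fin N → ℝ) : ℤ → Fin N → ℝ :=
  fun t j => Real.sign (path t j) * min |path t j| τ

/-- The response matrix, with rows `y_1, …, y_T`. -/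
def respMatrix {N : ℕ} (T : ℕ) (path : ℤ → Fin N → ℝ) : Matrix (Fin T) (VechIdx N) ℝ :=
  fun t => yVec path ((t : ℕ) + 1)

/-- The design matrix, with rows `x_1, …, x_T`. -/
def designMatrix {N : ℕ} (p T : ℕ) (path : ℤ → Fin N → ℝ) : Matrix (Fin T) (RegIdx N p) ℝ :=
  fun t => xVec p path ((t : ℕ) + 1)

/-- The objective `(2T)⁻¹ ‖Y(τ) - X(τ) Θ‖_F² + lam ‖Θ‖_{1,1}`. -/
def objective {N : ℕ} (p T : ℕ) (lam τ : ℝ) (path : ℤ → Fin N → ℝ)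
    (Θ : Matrix (RegIdx N p) (VechIdx N) ℝ) : ℝ :=
  1 / (2 * (T : ℝ)) * normF (respMatrix T (truncPath τ path)
    - designMatrix p T (truncPath τ path) * Θ) ^ 2 + lam * norm11 Θ

/-- `Θ` is a regularized least squares estimate for the data on the given path. -/
def IsRegularizedLSE {N : ℕ} (p T : ℕ) (lam τ : ℝ) (path : ℤ → Fin N → ℝ)
    (Θ : Matrix (RegIdx N p) (VechIdx N) ℝ) : Prop :=
  ∀ Θ' : Matrix (RegIdx N p) (VechIdx N) ℝ,
    objective p T lam τ path Θ ≤ objective p T lam τ path Θ'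

/-- `Γ_x = E(x_t x_tᵀ)`, at `t = 1` (the process is stationary). -/
def gramMatrix {Ω : Type*} [MeasurableSpace Ω] (μ : Measure Ω) {N : ℕ} (p : ℕ)
    (r : ℤ → Ω → Fin N → ℝ) : Matrix (RegIdx N p) (RegIdx N p) ℝ :=
  fun a b => ∫ ω, xVec p (fun u => r u ω) 1 a * xVec p (fun u => r u ω) 1 b ∂μ

/-- The smallest eigenvalue of a (symmetric) real matrix. -/
def lambdaMin {m : Type*} [Fintype m] [DecidableEq m] (B : Matrix m m ℝ) : ℝ :=
  sInf (spectrum ℝ B)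

/-- `log(p d + 1)`. -/
def logDim (N p : ℕ) : ℝ := Real.log ((p * vechDim N + 1 : ℕ) : ℝ)

/-- `T_eff = T / (log T)²`. -/
def Teff (T : ℕ) : ℝ := (T : ℝ) / Real.log T ^ 2

/-- `(M T_eff / log(p d + 1))^{1/(4+4ε)}`. -/
def tauScale (N p T : ℕ) (ε M : ℝ) : ℝ := (M * Teff T / logDim N p) ^ (1 / (4 + 4 * ε))

/-- `(M^{1/ε} log(p d + 1) / T_eff)^{ε/(1+ε)}`. -/
def rate (N p T : ℕ) (ε M : ℝ) : ℝ := (M ^ (1 / ε) * logDim N p / Teff T) ^ (ε / (1 + ε))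

end BEKK

end

/-! In vectorized form the model is a sparse regression. Entrywise `condCov` equals `Θ*ᵀ x_t`
(`condCov_apply_eq`) and is the conditional mean of `r_t r_tᵀ` given the past, so `E(x_t y_tᵀ) = Γ_x
Θ*` (`IsBEKKARCH.integral_pathMonomial`). The objective splits over the columns of `Θ`, and each
column is a lasso problem.

For one column, suppose the truncated sample moments are within `ρ` of `Γ_x` and `Γ_x Θ*`, with `ρ
(1 + ‖Θ*‖_{1,∞}) ≤ lam / 2`. Comparing `Θhat` with `Θ*` gives the usual cone condition, and also the
crude bound `‖Δ‖₁ ≤ 4 ‖Θ*‖_{1,∞}` on the error `Δ` of the column. The crude bound makes `ρ ‖Δ‖₁²` at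
most `2 lam ‖Δ‖₁`, so positive definiteness of `Γ_x` suffices and no smallness of `s ρ` is needed
(`lasso_error_le`). With `ρ` and `lam` proportional to `s R` and `s ‖Θ*‖_{1,∞} R`, this is the
asserted rate.

It remains to get `ρ = κ s R` uniformly over the entries, each a sample mean of a product of four
truncated coordinates (`measure_pathMonomial_deviation_le`). Truncation costs a bias of order `M
τ^(-4ε)`, and the bounded products have variance of order `M τ^(4(1-ε))`. Their fluctuations are
controlled by a Bernstein-type inequality for geometrically `α`-mixing processes that loses only one
factor `log T` (`measure_sum_ge_le_of_alphaMixing`). For it, exponential moments are bounded along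
Cantor-like sets of times, whose gaps grow with the size of the pieces they separate, so that mixing
beats the size of the exponentials. Jensen's inequality over all translates of such a set then
transfers the bound to the full sum. -/

noncomputable section

namespace BEKK

/-! ### Covariance inequality under α-mixing, and exponential moments along Cantor-type sets. -/

section Mixing

variable {Ω E : Type*} [MeasurableSpace E]

lemma pastSigma_le [MeasurableSpace Ω] {r : ℤ → Ω → E} (hr : ∀ t, Measurable (r t)) (t : ℤ) :
    pastSigma r t ≤ ‹MeasurableSpace Ω› :=
  iSup_le fun u => (hr u).comap_le

lemma futureSigma_le [MeasurableSpace Ω] {r : ℤ → Ω → E} (hr : ∀ t, Measurable (r t)) (t : ℤ) :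
    futureSigma r t ≤ ‹MeasurableSpace Ω› :=
  iSup_le fun u => (hr u).comap_le

lemma pastSigma_mono (r : ℤ → Ω → E) {s t : ℤ} (h : s ≤ t) : pastSigma r s ≤ pastSigma r t :=
  iSup_le fun u => le_iSup (fun v : {v : ℤ // v ≤ t} => MeasurableSpace.comap (r v) inferInstance)
    ⟨u.1, u.2.trans h⟩

lemma futureSigma_anti (r : ℤ → Ω → E) {s t : ℤ} (h : s ≤ t) :
    futureSigma r t ≤ futureSigma r s :=
  iSup_le fun u => le_iSup (fun v : {v : ℤ // s ≤ v} => MeasurableSpace.comap (r v) inferInstance)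
    ⟨u.1, h.trans u.2⟩

lemma measurable_pastSigma (r : ℤ → Ω → E) {u t : ℤ} (h : u ≤ t) :
    Measurable[pastSigma r t] (r u) :=
  Measurable.of_comap_le (le_iSup (fun v : {v : ℤ // v ≤ t} =>
    MeasurableSpace.comap (r v) inferInstance) ⟨u, h⟩)

lemma measurable_futureSigma (r : ℤ → Ω → E) {u t : ℤ} (h : t ≤ u) :
    Measurable[futureSigma r t] (r u) :=
  Measurable.of_comap_le (le_iSup (fun v : {v : ℤ // t ≤ v} =>
    MeasurableSpace.comap (r v) inferInstance) ⟨u, h⟩)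

lemma abs_measure_inter_sub_le_alphaMixing [MeasurableSpace Ω] (μ : Measure Ω) [IsProbabilityMeasure μ]
    (r : ℤ → Ω → E) {t u : ℤ} {l : ℕ} (h : t + l ≤ u) {A B : Set Ω}
    (hA : MeasurableSet[pastSigma r t] A) (hB : MeasurableSet[futureSigma r u] B) :
    |μ.real (A ∩ B) - μ.real A * μ.real B| ≤ alphaMixing μ r l := by
  refine le_csSup ⟨1, ?_⟩ ⟨t, A, B, hA, futureSigma_anti r h _ hB, rfl⟩
  rintro _ ⟨t, A, B, -, -, rfl⟩
  have h1 : μ.real (A ∩ B) ≤ 1 := measureReal_le_one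
  have h2 : μ.real A ≤ 1 := measureReal_le_one
  have h3 : μ.real B ≤ 1 := measureReal_le_one
  have h4 : 0 ≤ μ.real (A ∩ B) := measureReal_nonneg
  have h5 : 0 ≤ μ.real A := measureReal_nonneg
  have h6 : 0 ≤ μ.real B := measureReal_nonneg
  rw [abs_le]
  constructor <;> nlinarith [mul_nonneg h5 h6]

/-- A function with values in `[0, 1]` can be replaced by the indicator of an event of its own
σ-algebra without decreasing its covariance with `g`. -/
lemma exists_set_covariance_le {m m0 : MeasurableSpace Ω} (hm : m ≤ m0) (μ : @Measure Ω m0)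
    [IsProbabilityMeasure μ] {f g : Ω → ℝ} (hf : Measurable[m] f) (hf0 : ∀ ω, 0 ≤ f ω)
    (hf1 : ∀ ω, f ω ≤ 1) (hg : Integrable g μ) :
    ∃ A, MeasurableSet[m] A ∧
      ∫ ω, f ω * g ω ∂μ - (∫ ω, f ω ∂μ) * ∫ ω, g ω ∂μ ≤
        ∫ ω in A, g ω ∂μ - μ.real A * ∫ ω, g ω ∂μ := by
  set c := ∫ ω, g ω ∂μ
  have hfi : Integrable f μ := Integrable.of_bound (hf.mono hm le_rfl).aestronglyMeasurable 1
    (ae_of_all _ fun ω => by rw [Real.norm_eq_abs, abs_of_nonneg (hf0 ω)]; exact hf1 ω)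
  have hcm : Measurable[m] (μ[g|m]) := stronglyMeasurable_condExp.measurable
  have hci : Integrable (μ[g|m]) μ := integrable_condExp
  have hci' : Integrable (fun ω => (μ[g|m]) ω - c) μ := hci.sub (integrable_const c)
  -- The covariance is the integral of `f * (μ[g|m] - c)`; among `f` with values in `[0, 1]` it is
  -- largest for the indicator of the set where the second factor is positive.
  refine ⟨{ω | c < (μ[g|m]) ω}, measurableSet_lt measurable_const hcm, ?_⟩
  set A := {ω | c < (μ[g|m]) ω}
  have hA : MeasurableSet[m] A := measurableSet_lt measurable_const hcm
  have hfg : Integrable (fun ω => f ω * g ω) μ :=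
    hg.bdd_mul (hf.mono hm le_rfl).aestronglyMeasurable
      (ae_of_all _ fun ω => by rw [Real.norm_eq_abs, abs_of_nonneg (hf0 ω)]; exact hf1 ω)
  have h1 : ∫ ω, f ω * g ω ∂μ = ∫ ω, f ω * (μ[g|m]) ω ∂μ := by
    rw [← integral_condExp hm]
    exact integral_congr_ae (condExp_mul_of_stronglyMeasurable_left hf.stronglyMeasurable hfg hg)
  have hfc : Integrable (fun ω => f ω * (μ[g|m]) ω) μ :=
    hci.bdd_mul (hf.mono hm le_rfl).aestronglyMeasurable
      (ae_of_all _ fun ω => by rw [Real.norm_eq_abs, abs_of_nonneg (hf0 ω)]; exact hf1 ω)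
  have h2 : ∫ ω in A, g ω ∂μ = ∫ ω in A, (μ[g|m]) ω ∂μ := (setIntegral_condExp hm hg hA).symm
  have h3 : ∫ ω in A, (μ[g|m]) ω ∂μ - μ.real A * c = ∫ ω in A, ((μ[g|m]) ω - c) ∂μ := by
    rw [integral_sub hci.integrableOn (integrable_const c).integrableOn]
    simp
  have h4 : ∫ ω, f ω * (μ[g|m]) ω ∂μ - (∫ ω, f ω ∂μ) * c =
      ∫ ω, f ω * ((μ[g|m]) ω - c) ∂μ := by
    rw [← integral_mul_const, ← integral_sub hfc (hfi.mul_const c)]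
    simp_rw [mul_sub]
  rw [h1, h2, h3, h4, ← integral_indicator (hm _ hA)]
  refine integral_mono ?_ (hci'.indicator (hm _ hA)) fun ω => ?_
  · simp_rw [mul_sub]
    exact hfc.sub (hfi.mul_const c)
  · by_cases h : ω ∈ A
    · rw [Set.indicator_of_mem h]
      have : c < (μ[g|m]) ω := h
      dsimp only
      nlinarith [hf1 ω]
    · rw [Set.indicator_of_notMem h]
      have : (μ[g|m]) ω ≤ c := not_lt.1 h
      dsimp only
      nlinarith [hf0 ω]

/-- Covariance inequality for bounded nonnegative functions of the past and of the future. -/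
lemma integral_mul_le_of_alphaMixing [MeasurableSpace Ω] {μ : Measure Ω} [IsProbabilityMeasure μ]
    {r : ℤ → Ω → E} (hr : ∀ t, Measurable (r t)) {t u : ℤ} {l : ℕ} (h : t + l ≤ u)
    {f g : Ω → ℝ} (hf : Measurable[pastSigma r t] f) (hg : Measurable[futureSigma r u] g)
    {b : ℝ} (hb : 0 < b) (hf0 : ∀ ω, 0 ≤ f ω) (hfb : ∀ ω, f ω ≤ b) (hg0 : ∀ ω, 0 ≤ g ω)
    (hgb : ∀ ω, g ω ≤ b) :
    ∫ ω, f ω * g ω ∂μ ≤ (∫ ω, f ω ∂μ) * (∫ ω, g ω ∂μ) + b ^ 2 * alphaMixing μ r l := by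
  wlog hb1 : b = 1 generalizing f g b
  · have := this (f := fun ω => f ω / b) (g := fun ω => g ω / b) (hf.div_const b) (hg.div_const b)
      one_pos (fun ω => div_nonneg (hf0 ω) hb.le) (fun ω => (div_le_one hb).2 (hfb ω))
      (fun ω => div_nonneg (hg0 ω) hb.le) (fun ω => (div_le_one hb).2 (hgb ω)) rfl
    rw [integral_div, integral_div] at this
    have e : ∀ ω, f ω / b * (g ω / b) = f ω * g ω / b ^ 2 := fun ω => by field_simp
    simp_rw [e] at this
    rw [integral_div, div_le_iff₀ (by positivity)] at this
    refine this.trans_eq ?_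
    field_simp
  subst hb1
  have hgi : Integrable g μ := Integrable.of_bound
    (hg.mono (futureSigma_le hr u) le_rfl).aestronglyMeasurable 1
    (ae_of_all _ fun ω => by rw [Real.norm_eq_abs, abs_of_nonneg (hg0 ω)]; exact hgb ω)
  obtain ⟨A, hA, h1⟩ := exists_set_covariance_le (pastSigma_le hr t) μ hf hf0 hfb hgi
  have hA' := pastSigma_le hr t _ hA
  -- The second application is made against the indicator of `A`; what remains is the covariance of
  -- two events.
  obtain ⟨B, hB, h2⟩ := exists_set_covariance_le (futureSigma_le hr u) μ hg hg0 hgb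
    ((integrable_const (1 : ℝ)).indicator hA')
  have h3 := abs_measure_inter_sub_le_alphaMixing μ r h hA hB
  have hB' := futureSigma_le hr u _ hB
  have e1 : ∫ ω, g ω * A.indicator (fun _ => (1 : ℝ)) ω ∂μ = ∫ ω in A, g ω ∂μ := by
    rw [← integral_indicator hA']
    refine integral_congr_ae (ae_of_all _ fun ω => ?_)
    by_cases h : ω ∈ A <;> simp [h]
  have e2 : ∫ ω, A.indicator (fun _ => (1 : ℝ)) ω ∂μ = μ.real A := by
    rw [integral_indicator hA']; simp
  have e3 : ∫ ω in B, A.indicator (fun _ => (1 : ℝ)) ω ∂μ = μ.real (A ∩ B) := by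
    rw [integral_indicator hA']; simp [measureReal_restrict_apply hA']
  rw [e1, e2, e3] at h2
  have := (abs_le.1 h3).2
  linarith

/-- Sums over Cantor-type index sets: `2 ^ k` terms, the two halves at distance `h k`. -/
def cantorSum (h : ℕ → ℤ) (X : ℤ → Ω → ℝ) : ℕ → ℤ → Ω → ℝ
  | 0, j => X j
  | k + 1, j => fun ω => cantorSum h X k j ω + cantorSum h X k (j + h k) ω

lemma abs_cantorSum_le {h : ℕ → ℤ} {X : ℤ → Ω → ℝ} (hX : ∀ t ω, |X t ω| ≤ 1) (k : ℕ) (j : ℤ)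
    (ω : Ω) : |cantorSum h X k j ω| ≤ 2 ^ k := by
  induction k generalizing j with
  | zero => simpa [cantorSum] using hX j ω
  | succ k ih =>
    refine (abs_add_le _ _).trans ?_
    have := ih j; have := ih (j + h k)
    rw [pow_succ]; linarith

/-- As the translate `j` runs over `ℤ`, each time is visited `2 ^ k` times. This is what allows the
full sum to be recovered by averaging. -/
lemma hasSum_cantorSum {h : ℕ → ℤ} {X : ℤ → Ω → ℝ} {ω : Ω} {S : ℝ}
    (hS : HasSum (fun t => X t ω) S) (k : ℕ) :
    HasSum (fun j => cantorSum h X k j ω) (2 ^ k * S) := by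
  induction k with
  | zero => simpa [cantorSum] using hS
  | succ k ih =>
    have h2 : HasSum (fun j => cantorSum h X k (j + h k) ω) (2 ^ k * S) :=
      (Equiv.addRight (h k)).hasSum_iff.2 ih
    rw [pow_succ, mul_assoc, two_mul, mul_add]
    exact ih.add h2

/-- The step and diameter of the Cantor-type index sets. -/
def cantorDiam (G c : ℕ) (k : ℕ) : ℤ := 2 ^ k * (G * k + c) - c

/-- See `cantorDiam`. -/
def cantorStep (G c : ℕ) (k : ℕ) : ℤ := cantorDiam G c k + G * 2 ^ k + c

/-- `cantorDiam` is a closed-form upper bound for the diameter, with slack `G * 2 ^ k` at this step.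
-/
lemma cantorDiam_add_step (G c k : ℕ) :
    cantorDiam G c k + cantorStep G c k ≤ cantorDiam G c (k + 1) := by
  unfold cantorStep cantorDiam
  push_cast
  have : (0 : ℤ) ≤ G * 2 ^ k := by positivity
  rw [pow_succ]
  nlinarith

lemma cantorDiam_nonneg (G c k : ℕ) : 0 ≤ cantorDiam G c k := by
  unfold cantorDiam
  have h1 : (1 : ℤ) ≤ 2 ^ k := one_le_pow₀ (by norm_num)
  have h2 : (0 : ℤ) ≤ G * k := by positivity
  have h3 : (0 : ℤ) ≤ c := by positivity
  nlinarith

lemma cantorStep_nonneg (G c k : ℕ) : 0 ≤ cantorStep G c k := by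
  have := cantorDiam_nonneg G c k
  unfold cantorStep
  positivity

lemma cantorSum_eq_zero {G c : ℕ} {X : ℤ → Ω → ℝ} {T : ℤ} {ω : Ω}
    (hX : ∀ t, t ∉ Finset.Ioc 0 T → X t ω = 0) (k : ℕ) (j : ℤ)
    (hj : j ∉ Finset.Ioc (-cantorDiam G c k) T) : cantorSum (cantorStep G c) X k j ω = 0 := by
  induction k generalizing j with
  | zero => exact hX j (by simpa [cantorDiam] using hj)
  | succ k ih =>
    have h1 := cantorDiam_add_step G c k
    have h2 := cantorStep_nonneg G c k
    simp only [Finset.mem_Ioc, not_and_or, not_lt, not_le] at hj ih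
    change cantorSum _ X k j ω + cantorSum _ X k (j + _) ω = 0
    rw [ih j (by omega), ih (j + _) (by omega), add_zero]

lemma measurable_cantorSum {r : ℤ → Ω → E} {p G c : ℕ} {X : ℤ → Ω → ℝ}
    (hXp : ∀ t, Measurable[pastSigma r t] (X t))
    (hXf : ∀ t, Measurable[futureSigma r (t - p)] (X t)) (k : ℕ) (j : ℤ) :
    Measurable[pastSigma r (j + cantorDiam G c k)] (cantorSum (cantorStep G c) X k j) ∧
    Measurable[futureSigma r (j - p)] (cantorSum (cantorStep G c) X k j) := by
  induction k generalizing j with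
  | zero =>
    have : cantorDiam G c 0 = 0 := by simp [cantorDiam]
    rw [this, add_zero]
    exact ⟨hXp j, hXf j⟩
  | succ k ih =>
    have h1 := cantorDiam_add_step G c k
    have h2 := cantorStep_nonneg G c k
    constructor
    · exact ((ih j).1.mono (pastSigma_mono r (by omega)) le_rfl).add
        ((ih _).1.mono (pastSigma_mono r (by omega)) le_rfl)
    · exact ((ih j).2.mono (futureSigma_anti r (by omega)) le_rfl).add
        ((ih _).2.mono (futureSigma_anti r (by omega)) le_rfl)

/-- The two halves lie `G * (2 ^ k + m) + p` apart, and `p` of this gap absorbs the lags on which `X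
t` depends. Each exponential is at most `exp (2 ^ k)`, so decoupling the halves costs at most `δ`;
the exponent obeys `w ↦ 2 * w + δ`, solved by the stated expression. -/
lemma integral_exp_cantorSum_le [MeasurableSpace Ω] {μ : Measure Ω} [IsProbabilityMeasure μ] {r : ℤ → Ω → E}
    (hr : ∀ t, Measurable (r t)) {p G m : ℕ} {X : ℤ → Ω → ℝ}
    (hXp : ∀ t, Measurable[pastSigma r t] (X t))
    (hXf : ∀ t, Measurable[futureSigma r (t - p)] (X t)) (hX : ∀ t ω, |X t ω| ≤ 1)
    {a δ : ℝ} (ha : ∀ t, ∫ ω, Real.exp (X t ω) ∂μ ≤ Real.exp a) (ha0 : 0 ≤ a) (hδ : 0 ≤ δ)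
    (hα : ∀ k : ℕ, Real.exp (2 ^ k) ^ 2 * alphaMixing μ r (G * (2 ^ k + m)) ≤ δ)
    (k : ℕ) (j : ℤ) :
    ∫ ω, Real.exp (cantorSum (cantorStep G (G * m + p)) X k j ω) ∂μ ≤
      Real.exp (2 ^ k * (a + δ) - δ) := by
  induction k generalizing j with
  | zero => simpa [cantorSum] using ha j
  | succ k ih =>
    set W := cantorSum (cantorStep G (G * m + p)) X with hW
    have hm := measurable_cantorSum (G := G) (c := G * m + p) hXp hXf k
    have key := integral_mul_le_of_alphaMixing (μ := μ) hr (l := G * (2 ^ k + m))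
      (t := j + cantorDiam G (G * m + p) k) (u := j + cantorStep G (G * m + p) k - p)
      (by unfold cantorStep; push_cast; ring_nf; rfl)
      (f := fun ω => Real.exp (W k j ω))
      (g := fun ω => Real.exp (W k (j + cantorStep G (G * m + p) k) ω))
      ((hm j).1.exp) ((hm _).2.exp) (Real.exp_pos (2 ^ k))
      (fun ω => (Real.exp_pos _).le)
      (fun ω => Real.exp_le_exp.2 ((le_abs_self _).trans (abs_cantorSum_le hX k _ ω)))
      (fun ω => (Real.exp_pos _).le)
      (fun ω => Real.exp_le_exp.2 ((le_abs_self _).trans (abs_cantorSum_le hX k _ ω)))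
    have e : ∀ ω, Real.exp (W (k + 1) j ω) = Real.exp (W k j ω) *
        Real.exp (W k (j + cantorStep G (G * m + p) k) ω) := fun ω => by
      rw [← Real.exp_add]; rfl
    simp_rw [e]
    set w := 2 ^ k * (a + δ) - δ with hw
    have hw0 : 0 ≤ w := by
      have : (1 : ℝ) ≤ 2 ^ k := one_le_pow₀ (by norm_num)
      nlinarith
    have h1 : (∫ ω, Real.exp (W k j ω) ∂μ) *
        (∫ ω, Real.exp (W k (j + cantorStep G (G * m + p) k) ω) ∂μ) ≤ Real.exp w * Real.exp w :=
      mul_le_mul (ih j) (ih _) (integral_nonneg fun ω => (Real.exp_pos _).le) (Real.exp_pos _).le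
    have h2 : (2 : ℝ) ^ (k + 1) * (a + δ) - δ = w + w + δ := by rw [hw]; ring
    rw [h2, Real.exp_add, Real.exp_add]
    -- Since the product is at least `1`, the additive error `δ` can be absorbed into a factor `exp
    -- δ`.
    have h3 : 1 ≤ Real.exp w * Real.exp w := by
      have := Real.one_le_exp hw0; nlinarith
    have h4 := Real.add_one_le_exp δ
    have h5 := hα k
    nlinarith

end Mixing

/-! ### Bernstein-type tail bound for sums of a mixing process. -/

section MixingTail

lemma sum_Ioc_int_eq_sum_fin (f : ℤ → ℝ) (T : ℕ) :
    ∑ t ∈ Finset.Ioc (0 : ℤ) T, f t = ∑ t : Fin T, f ((t : ℕ) + 1) := by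
  induction T with
  | zero => simp
  | succ T ih =>
    have : Finset.Ioc (0 : ℤ) ((T + 1 : ℕ) : ℤ) = insert ((T : ℤ) + 1) (Finset.Ioc (0 : ℤ) T) := by
      ext x; simp only [Finset.mem_Ioc, Finset.mem_insert]; push_cast; omega
    rw [this, Finset.sum_insert (by simp), ih, Fin.sum_univ_castSucc, add_comm]
    simp

lemma exists_pow_le_exp_neg_two {ζbar : ℝ} (h : ζbar < 1) :
    ∃ G : ℕ, 1 ≤ G ∧ ∀ ζ, 0 ≤ ζ → ζ ≤ ζbar → ζ ^ G ≤ Real.exp (-2) := by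
  obtain ⟨n, hn⟩ := exists_pow_lt_of_lt_one (Real.exp_pos (-2)) h
  refine ⟨n, ?_, fun ζ h0 h1 => (pow_le_pow_left₀ h0 h1 n).trans hn.le⟩
  refine Nat.one_le_iff_ne_zero.2 fun h0 => ?_
  rw [h0, pow_zero, ← Real.exp_zero, Real.exp_lt_exp] at hn
  norm_num at hn

lemma half_lt_log {T : ℕ} (hT : 2 ≤ T) : 1 / 2 < Real.log T := by
  have h1 := Real.log_two_gt_d9
  have h2 : Real.log 2 ≤ Real.log T := Real.log_le_log (by norm_num) (by exact_mod_cast hT)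
  linarith

/-- The depth `K` of the Cantor set: with `2 ^ K` points, of order `T / log T`, and gaps adding up
to order `2 ^ K * log T`, its diameter is of order `T`. -/
lemma exists_pow_two_mul_log_le {T : ℕ} (hT : 2 ≤ T) :
    ∃ K : ℕ, 2 ^ K * Real.log T ≤ T ∧ (T : ℝ) ≤ 2 ^ (K + 1) * Real.log T ∧
      (K : ℝ) ≤ 3 * Real.log T := by
  have hl := half_lt_log hT
  have hT0 : (0 : ℝ) < T := by positivity
  have h1 : (1 : ℝ) ≤ T / Real.log T := by
    rw [le_div_iff₀ (by linarith), one_mul]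
    have := Real.log_le_sub_one_of_pos hT0
    linarith
  obtain ⟨K, hK1, hK2⟩ := exists_nat_pow_near h1 (show (1 : ℝ) < 2 by norm_num)
  rw [le_div_iff₀ (by linarith)] at hK1
  rw [div_lt_iff₀ (by linarith)] at hK2
  refine ⟨K, hK1, hK2.le, ?_⟩
  have h2 : (2 : ℝ) ^ K ≤ 2 * T := by
    have : (0 : ℝ) < 2 ^ K := by positivity
    nlinarith
  have h3 := Real.log_le_log (by positivity) h2
  rw [Real.log_pow, Real.log_mul (by norm_num) hT0.ne'] at h3
  have h4 := Real.log_two_gt_d9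
  have h5 : Real.log 2 ≤ Real.log T := Real.log_le_log (by norm_num) (by exact_mod_cast hT)
  have h6 : (0 : ℝ) ≤ K := by positivity
  nlinarith

variable {Ω E : Type*} [MeasurableSpace Ω] [MeasurableSpace E]

/-- Bernstein-type tail bound, with a single logarithmic factor, for a geometrically `α`-mixing
process. -/
lemma measure_sum_ge_le_of_alphaMixing {μ : Measure Ω} [IsProbabilityMeasure μ] {r : ℤ → Ω → E}
    (hr : ∀ t, Measurable (r t)) {p G T : ℕ} (hG : 1 ≤ G) (hT : 2 ≤ T) {ζ C : ℝ} (hζ : 0 ≤ ζ)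
    (hζG : ζ ^ G ≤ Real.exp (-2)) (hC : 0 ≤ C)
    (hα : ∀ l : ℕ, 1 ≤ l → alphaMixing μ r l ≤ C * ζ ^ l) {X : ℤ → Ω → ℝ}
    (hXp : ∀ t, Measurable[pastSigma r t] (X t))
    (hXf : ∀ t, Measurable[futureSigma r (t - p)] (X t)) (hX : ∀ t ω, |X t ω| ≤ 1)
    {a : ℝ} (ha : ∀ t, ∫ ω, Real.exp (X t ω) ∂μ ≤ Real.exp a) (ha0 : 0 ≤ a)
    {y : ℝ} (hy : 0 ≤ y) :
    μ.real {ω | y ≤ ∑ t ∈ Finset.Ioc (0 : ℤ) T, X t ω} ≤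
      Real.exp (-(y / ((2 + 6 * G + 2 * p) * Real.log T)) + (T * a + C) / Real.log T) := by
  obtain ⟨K, hK1, hK2, hK3⟩ := exists_pow_two_mul_log_le hT
  have hl := half_lt_log hT
  have hl0 : 0 < Real.log T := by linarith
  have hT0 : (0 : ℝ) < T := by positivity
  -- The extra gap `G * m` adds a factor at most `1 / T` to the mixing error, so all `2 ^ K`
  -- decouplings together cost at most `C / log T`.
  set m := ⌈Real.log T⌉₊ with hm
  have hm1 : Real.log T ≤ m := Nat.le_ceil _
  have hm2 : (m : ℝ) < Real.log T + 1 := Nat.ceil_lt_add_one hl0.le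
  set c := G * m + p with hc
  set δ := C / T with hδ
  have hδ0 : 0 ≤ δ := by positivity
  have hαδ : ∀ k : ℕ, Real.exp (2 ^ k) ^ 2 * alphaMixing μ r (G * (2 ^ k + m)) ≤ δ := fun k => by
    have h1 := hα (G * (2 ^ k + m)) (Nat.mul_pos hG (by positivity))
    have h2 : ζ ^ (G * (2 ^ k + m)) ≤ Real.exp (-2 * (2 ^ k + m)) := by
      rw [pow_mul]
      refine (pow_le_pow_left₀ (by positivity) hζG _).trans_eq ?_
      rw [← Real.exp_nat_mul]
      push_cast
      ring_nf
    have h3 : Real.exp (2 ^ k) ^ 2 * Real.exp (-2 * (2 ^ k + m)) ≤ 1 / T := by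
      rw [← Real.exp_nat_mul, ← Real.exp_add, show 1 / (T : ℝ) = Real.exp (-Real.log T) by
        rw [Real.exp_neg, Real.exp_log hT0, one_div]]
      refine Real.exp_le_exp.2 ?_
      push_cast
      linarith
    calc Real.exp (2 ^ k) ^ 2 * alphaMixing μ r (G * (2 ^ k + m))
        ≤ Real.exp (2 ^ k) ^ 2 * (C * Real.exp (-2 * (2 ^ k + m))) := by gcongr; exact h1.trans (by gcongr)
      _ = C * (Real.exp (2 ^ k) ^ 2 * Real.exp (-2 * (2 ^ k + m))) := by ring
      _ ≤ C * (1 / T) := by gcongr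
      _ = δ := by rw [hδ]; ring
  -- Cutting off outside `(0, T]` lets translates overhang the sample; only those in `J` contribute.
  set Y : ℤ → Ω → ℝ := fun t => if t ∈ Finset.Ioc (0 : ℤ) T then X t else 0 with hY
  have hYp : ∀ t, Measurable[pastSigma r t] (Y t) := fun t => by
    simp only [hY]; split_ifs
    exacts [hXp t, measurable_const]
  have hYf : ∀ t, Measurable[futureSigma r (t - p)] (Y t) := fun t => by
    simp only [hY]; split_ifs
    exacts [hXf t, measurable_const]
  have hY1 : ∀ t ω, |Y t ω| ≤ 1 := fun t ω => by
    simp only [hY]; split_ifs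
    exacts [hX t ω, by simp]
  have hYa : ∀ t, ∫ ω, Real.exp (Y t ω) ∂μ ≤ Real.exp a := fun t => by
    simp only [hY]; split_ifs
    exacts [ha t, by simpa using ha0]
  have hY0 : ∀ ω t, t ∉ Finset.Ioc (0 : ℤ) T → Y t ω = 0 := fun ω t ht => by simp only [hY, if_neg ht, Pi.zero_apply]
  set W := cantorSum (cantorStep G c) Y K with hW
  set D := cantorDiam G c K with hD
  have hD0 : 0 ≤ D := cantorDiam_nonneg G c K
  set J := Finset.Ioc (-D) (T : ℤ) with hJ
  have hJcard : (J.card : ℝ) = T + D := by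
    rw [hJ, Int.card_Ioc]
    rw [← Int.cast_natCast (R := ℝ), Int.toNat_of_nonneg (by omega)]
    push_cast
    ring
  have hD0' : (0 : ℝ) ≤ D := by exact_mod_cast hD0
  have hJ0 : (0 : ℝ) < J.card := by rw [hJcard]; linarith
  have hsum : ∀ ω, ∑ j ∈ J, W j ω = 2 ^ K * ∑ t ∈ Finset.Ioc (0 : ℤ) T, X t ω := fun ω => by
    have h1 : HasSum (fun t => Y t ω) (∑ t ∈ Finset.Ioc (0 : ℤ) T, Y t ω) :=
      hasSum_sum_of_ne_finset_zero (hY0 ω)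
    have h2 : HasSum (fun j => W j ω) (∑ j ∈ J, W j ω) :=
      hasSum_sum_of_ne_finset_zero (cantorSum_eq_zero (hY0 ω) K)
    rw [h2.unique (hasSum_cantorSum h1 K)]
    congr 1
    exact Finset.sum_congr rfl fun t ht => by simp only [hY, if_pos ht]
  set q : ℝ := J.card / 2 ^ K with hq
  have hq0 : 0 < q := by positivity
  have hqle : q ≤ (2 + 6 * G + 2 * p) * Real.log T := by
    rw [hq, hJcard, div_le_iff₀ (by positivity)]
    have hDle : (D : ℝ) ≤ 2 ^ K * (G * K + c) := by
      rw [hD]; unfold cantorDiam; push_cast; linarith [show (0 : ℝ) ≤ c by positivity]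
    have h1 : (G : ℝ) * K + c ≤ (6 * G + 2 * p) * Real.log T := by
      rw [hc]; push_cast
      have hG0 : (0 : ℝ) ≤ G := by positivity
      have hp0 : (0 : ℝ) ≤ p := by positivity
      have e1 : (G : ℝ) * K ≤ G * (3 * Real.log T) := by gcongr
      have e2 : (G : ℝ) * m ≤ G * (3 * Real.log T) := by gcongr; linarith
      have e3 : (p : ℝ) ≤ p * (2 * Real.log T) := le_mul_of_one_le_right hp0 (by linarith)
      linarith
    have h2 : (2 : ℝ) ^ K * (G * K + c) ≤ 2 ^ K * ((6 * G + 2 * p) * Real.log T) := by gcongr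
    rw [pow_succ] at hK2
    nlinarith
  set S : Ω → ℝ := fun ω => ∑ t ∈ Finset.Ioc (0 : ℤ) T, X t ω with hS
  have hXm : ∀ t, Measurable (X t) := fun t => (hXp t).mono (pastSigma_le hr t) le_rfl
  have hSm : Measurable S := Finset.measurable_sum _ fun t _ => hXm t
  have hWm : ∀ j, Measurable (W j) := fun j =>
    (measurable_cantorSum hYp hYf K j).1.mono (pastSigma_le hr _) le_rfl
  have hWi : ∀ j, Integrable (fun ω => Real.exp (W j ω)) μ := fun j =>
    Integrable.of_bound (hWm j).exp.aestronglyMeasurable (Real.exp (2 ^ K))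
      (ae_of_all _ fun ω => by
        rw [Real.norm_eq_abs, Real.abs_exp]
        exact Real.exp_le_exp.2 ((le_abs_self _).trans (abs_cantorSum_le hY1 K j ω)))
  -- Jensen: `S / q` is the mean of the Cantor sums over the translates, so `q`, of order `log T`,
  -- is the only loss against independence.
  have hpt : ∀ ω, Real.exp (S ω / q) ≤ ∑ j ∈ J, (1 / (J.card : ℝ)) * Real.exp (W j ω) := fun ω => by
    have h1 := convexOn_exp.map_sum_le (t := J) (w := fun _ => 1 / (J.card : ℝ))
      (p := fun j => W j ω) (fun _ _ => by positivity)
      (by rw [Finset.sum_const, nsmul_eq_mul]; field_simp) (fun _ _ => Set.mem_univ _)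
    simp only [smul_eq_mul] at h1
    rw [← Finset.mul_sum, hsum, ← Finset.mul_sum] at h1
    rw [show S ω / q = 1 / (J.card : ℝ) * (2 ^ K * S ω) by rw [hq]; field_simp]
    rw [← Finset.mul_sum]
    exact h1
  set w := 2 ^ K * (a + δ) - δ with hw
  have hint : ∫ ω, Real.exp (S ω / q) ∂μ ≤ Real.exp w := by
    calc ∫ ω, Real.exp (S ω / q) ∂μ
        ≤ ∫ ω, ∑ j ∈ J, (1 / (J.card : ℝ)) * Real.exp (W j ω) ∂μ :=
          integral_mono_of_nonneg (ae_of_all _ fun ω => (Real.exp_pos _).le)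
            (integrable_finsetSum _ fun j _ => (hWi j).const_mul _) (ae_of_all _ hpt)
      _ = ∑ j ∈ J, (1 / (J.card : ℝ)) * ∫ ω, Real.exp (W j ω) ∂μ := by
          rw [integral_finsetSum _ fun j _ => (hWi j).const_mul _]
          simp_rw [integral_const_mul]
      _ ≤ ∑ j ∈ J, (1 / (J.card : ℝ)) * Real.exp w := by
          gcongr with j
          exact integral_exp_cantorSum_le hr hYp hYf hY1 hYa ha0 hδ0 hαδ K j
      _ = Real.exp w := by rw [Finset.sum_const, nsmul_eq_mul]; field_simp
  have hSi : Integrable (fun ω => Real.exp (S ω / q)) μ :=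
    Integrable.mono' (integrable_finsetSum J fun j _ => (hWi j).const_mul (1 / (J.card : ℝ)))
      (hSm.div_const q).exp.aestronglyMeasurable
      (ae_of_all _ fun ω => by rw [Real.norm_eq_abs, Real.abs_exp]; exact hpt ω)
  have hmk := mul_meas_ge_le_integral_of_nonneg (μ := μ) (f := fun ω => Real.exp (S ω / q))
    (ae_of_all _ fun ω => (Real.exp_pos _).le) hSi (Real.exp (y / q))
  have hset : {ω | y ≤ S ω} = {ω | Real.exp (y / q) ≤ Real.exp (S ω / q)} := by
    ext ω
    simp only [Set.mem_ofPred_eq, Real.exp_le_exp]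
    rw [div_le_div_iff_of_pos_right hq0]
  have h1 : μ.real {ω | y ≤ S ω} ≤ Real.exp (-(y / q) + w) := by
    rw [Real.exp_add, Real.exp_neg, hset, inv_mul_eq_div, le_div_iff₀' (Real.exp_pos _)]
    exact hmk.trans hint
  refine h1.trans (Real.exp_le_exp.2 (add_le_add (neg_le_neg ?_) ?_))
  · exact div_le_div_of_nonneg_left hy hq0 hqle
  · have h2 : (2 : ℝ) ^ K ≤ T / Real.log T := by rwa [le_div_iff₀ hl0]
    have h3 : (2 : ℝ) ^ K * (a + δ) ≤ T / Real.log T * (a + δ) := by gcongr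
    have h4 : T / Real.log T * (a + δ) = (T * a + C) / Real.log T := by
      rw [hδ]; field_simp
    linarith

end MixingTail

/-! ### Deterministic analysis of the lasso. -/

section Lasso

/-- Deterministic error bound for a single `ℓ₁`-penalized least squares regression, whose sample
second moments are uniformly close to the population ones. -/
lemma lasso_error_le {n ι : Type*} [Fintype n] [Fintype ι] (c : ℝ) (hc : 0 ≤ c)
    (X : n → ι → ℝ) (y : n → ℝ) (Γ : ι → ι → ℝ) (θ θ' : ι → ℝ) {lam ρ B κ : ℝ} {s : ℕ}
    (hlam : 0 < lam) (hκ : 0 < κ) (hρ : 0 ≤ ρ)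
    (hmin : c / 2 * ∑ t, (y t - ∑ i, X t i * θ' i) ^ 2 + lam * ∑ i, |θ' i| ≤
      c / 2 * ∑ t, (y t - ∑ i, X t i * θ i) ^ 2 + lam * ∑ i, |θ i|)
    (hG : ∀ i j, |c * ∑ t, X t i * X t j - Γ i j| ≤ ρ)
    (hg : ∀ i, |c * ∑ t, X t i * y t - ∑ j, Γ i j * θ j| ≤ ρ)
    (hB : ∑ i, |θ i| ≤ B) (hρB : ρ * (1 + B) ≤ lam / 2)
    (hs : {i | θ i ≠ 0}.ncard ≤ s)
    (hΓ : ∀ v : ι → ℝ, κ * ∑ i, v i ^ 2 ≤ ∑ i, ∑ j, Γ i j * v i * v j) :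
    √(∑ i, (θ' i - θ i) ^ 2) ≤ 20 * (√s * lam * κ⁻¹) := by
  classical
  set Δ : ι → ℝ := fun i => θ' i - θ i with hΔ
  set G : ι → ι → ℝ := fun i j => c * ∑ t, X t i * X t j with hGdef
  set h : ι → ℝ := fun i => c * ∑ t, X t i * (y t - ∑ j, X t j * θ j) with hh
  have hquad : ∑ i, ∑ j, G i j * Δ i * Δ j = c * ∑ t, (∑ i, X t i * Δ i) ^ 2 := by
    simp only [hGdef, sq, Finset.mul_sum, Finset.sum_mul]
    rw [Finset.sum_comm' (t' := Finset.univ) (s' := fun _ => Finset.univ) (by simp)]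
    calc _ = ∑ i, ∑ t, ∑ j, c * (X t i * X t j) * Δ i * Δ j := by
          rw [Finset.sum_comm]
          exact Finset.sum_congr rfl fun _ _ => Finset.sum_comm
      _ = ∑ t, ∑ i, ∑ j, c * (X t i * X t j) * Δ i * Δ j := Finset.sum_comm
      _ = _ := by
          refine Finset.sum_congr rfl fun _ _ => Finset.sum_congr rfl fun _ _ =>
            Finset.sum_congr rfl fun _ _ => ?_
          ring
  have hcross : ∑ i, h i * Δ i = c * ∑ t, (y t - ∑ j, X t j * θ j) * ∑ i, X t i * Δ i := by
    simp only [hh, Finset.mul_sum, Finset.sum_mul]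
    rw [Finset.sum_comm]
    refine Finset.sum_congr rfl fun _ _ => Finset.sum_congr rfl fun _ _ => ?_
    ring
  have hexp : c / 2 * ∑ t, (y t - ∑ i, X t i * θ' i) ^ 2 =
      c / 2 * ∑ t, (y t - ∑ i, X t i * θ i) ^ 2 - ∑ i, h i * Δ i +
        (∑ i, ∑ j, G i j * Δ i * Δ j) / 2 := by
    rw [hquad, hcross]
    have e : ∀ t, (y t - ∑ i, X t i * θ' i) ^ 2 = (y t - ∑ i, X t i * θ i) ^ 2
        - 2 * ((y t - ∑ j, X t j * θ j) * ∑ i, X t i * Δ i) + (∑ i, X t i * Δ i) ^ 2 := fun t => by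
      have : ∑ i, X t i * Δ i = ∑ i, X t i * θ' i - ∑ i, X t i * θ i := by
        rw [← Finset.sum_sub_distrib]
        exact Finset.sum_congr rfl fun _ _ => by simp only [hΔ]; ring
      rw [this]; ring
    simp_rw [e]
    rw [Finset.sum_add_distrib, Finset.sum_sub_distrib, ← Finset.mul_sum]
    ring
  -- The population score `Γ θ - Γ θ` vanishes, so the sample score consists of moment deviations
  -- only.
  have hh1 : ∀ i, |h i| ≤ lam / 2 := fun i => by
    have e : h i = (c * ∑ t, X t i * y t - ∑ j, Γ i j * θ j) - ∑ j, (G i j - Γ i j) * θ j := by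
      have : ∑ j, G i j * θ j = c * ∑ t, X t i * ∑ j, X t j * θ j := by
        simp only [hGdef, Finset.mul_sum, Finset.sum_mul]
        rw [Finset.sum_comm]
        refine Finset.sum_congr rfl fun _ _ => Finset.sum_congr rfl fun _ _ => ?_
        ring
      simp only [hh, sub_mul, mul_sub, Finset.sum_sub_distrib, this]
      ring
    have h2 : |∑ j, (G i j - Γ i j) * θ j| ≤ ρ * B := by
      refine (Finset.abs_sum_le_sum_abs _ _).trans ?_
      calc ∑ j, |(G i j - Γ i j) * θ j| ≤ ∑ j, ρ * |θ j| := by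
            refine Finset.sum_le_sum fun j _ => ?_
            rw [abs_mul]
            exact mul_le_mul_of_nonneg_right (hG i j) (abs_nonneg _)
        _ = ρ * ∑ j, |θ j| := by rw [Finset.mul_sum]
        _ ≤ ρ * B := by gcongr
    rw [e]
    refine (abs_sub _ _).trans ?_
    have := hg i
    linarith
  have hcb : ∑ i, h i * Δ i ≤ lam / 2 * ∑ i, |Δ i| := by
    rw [Finset.mul_sum]
    refine Finset.sum_le_sum fun i _ => (le_abs_self _).trans ?_
    rw [abs_mul]
    exact mul_le_mul_of_nonneg_right (hh1 i) (abs_nonneg _)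
  have hq0 : 0 ≤ ∑ i, ∑ j, G i j * Δ i * Δ j := by
    rw [hquad]; exact mul_nonneg hc (Finset.sum_nonneg fun _ _ => sq_nonneg _)
  have hbasic : (∑ i, ∑ j, G i j * Δ i * Δ j) / 2 ≤
      lam / 2 * ∑ i, |Δ i| + lam * (∑ i, |θ i| - ∑ i, |θ' i|) := by
    rw [hexp] at hmin; linarith
  set A := ∑ i, |θ i|
  set A' := ∑ i, |θ' i|
  set D := ∑ i, |Δ i| with hD
  have hD0 : 0 ≤ D := Finset.sum_nonneg fun _ _ => abs_nonneg _
  have hDA : D ≤ A' + A := by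
    rw [← Finset.sum_add_distrib]
    exact Finset.sum_le_sum fun i _ => abs_sub _ _
  have hAD : A - A' ≤ D := by
    rw [← Finset.sum_sub_distrib]
    refine Finset.sum_le_sum fun i _ => ?_
    have := abs_sub_abs_le_abs_sub (θ i) (θ' i)
    rw [abs_sub_comm] at this
    exact this
  -- Nonnegativity of the quadratic form. With `D ≤ A' + A` it gives `D ≤ 4 * A`; with `hcone` it
  -- gives `D ≤ 4 * ∑ i ∈ S, |Δ i|`.
  have h1 : 0 ≤ D / 2 + (A - A') := by
    have : 0 ≤ lam * (D / 2 + (A - A')) := by linarith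
    exact nonneg_of_mul_nonneg_right this hlam
  have hD4 : D ≤ 4 * B := by linarith
  set S : Finset ι := {i | θ i ≠ 0} with hS
  have hScard : S.card ≤ s := by
    rw [Set.ncard_eq_toFinset_card'] at hs
    refine le_trans (le_of_eq ?_) hs
    congr 1
    ext i; simp [hS]
  have hsplit : ∀ f : ι → ℝ, ∑ i, f i = ∑ i ∈ S, f i + ∑ i ∈ Sᶜ, f i := fun f =>
    (Finset.sum_add_sum_compl S f).symm
  have hz : ∀ i ∈ Sᶜ, θ i = 0 := fun i hi => by simpa [hS] using hi
  have hcone : A - A' ≤ ∑ i ∈ S, |Δ i| - ∑ i ∈ Sᶜ, |Δ i| := by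
    have e1 : A = ∑ i ∈ S, |θ i| := by
      refine (hsplit _).trans ?_
      rw [Finset.sum_eq_zero (s := Sᶜ) fun i hi => by rw [hz i hi, abs_zero], add_zero]
    have e2 : A' = ∑ i ∈ S, |θ' i| + ∑ i ∈ Sᶜ, |Δ i| := by
      refine (hsplit _).trans ?_
      congr 1
      exact Finset.sum_congr rfl fun i hi => by simp only [hΔ, hz i hi, sub_zero]
    have e3 : ∑ i ∈ S, |θ i| - ∑ i ∈ S, |θ' i| ≤ ∑ i ∈ S, |Δ i| := by
      rw [← Finset.sum_sub_distrib]
      refine Finset.sum_le_sum fun i _ => ?_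
      have := abs_sub_abs_le_abs_sub (θ i) (θ' i)
      rw [abs_sub_comm] at this
      exact this
    rw [e1, e2]; linarith
  have hDS : D ≤ 4 * ∑ i ∈ S, |Δ i| := by
    have := hsplit fun i => |Δ i|
    linarith
  set Q := ∑ i, Δ i ^ 2 with hQ
  have hQ0 : 0 ≤ Q := Finset.sum_nonneg fun _ _ => sq_nonneg _
  have hCS : ∑ i ∈ S, |Δ i| ≤ √s * √Q := by
    rw [← Real.sqrt_mul (by positivity)]
    refine Real.le_sqrt_of_sq_le ?_
    refine (sq_sum_le_card_mul_sum_sq (s := S) (f := fun i => |Δ i|)).trans ?_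
    simp only [sq_abs]
    refine mul_le_mul (by exact_mod_cast hScard)
      (Finset.sum_le_sum_of_subset_of_nonneg (Finset.subset_univ _) fun _ _ _ => sq_nonneg _)
      (Finset.sum_nonneg fun _ _ => sq_nonneg _) (by positivity)
  have hdev : ∑ i, ∑ j, Γ i j * Δ i * Δ j ≤ ∑ i, ∑ j, G i j * Δ i * Δ j + ρ * D ^ 2 := by
    have : ρ * D ^ 2 = ∑ i, ∑ j, ρ * (|Δ i| * |Δ j|) := by
      rw [sq, hD, Finset.sum_mul_sum, Finset.mul_sum]
      simp_rw [Finset.mul_sum]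
    rw [this, ← Finset.sum_add_distrib]
    refine Finset.sum_le_sum fun i _ => ?_
    rw [← Finset.sum_add_distrib]
    refine Finset.sum_le_sum fun j _ => ?_
    have h2 := hG i j
    have h3 : (Γ i j - G i j) * (Δ i * Δ j) ≤ ρ * (|Δ i| * |Δ j|) := by
      refine (le_abs_self _).trans ?_
      rw [abs_mul, abs_mul, abs_sub_comm]
      exact mul_le_mul_of_nonneg_right h2 (by positivity)
    linarith
  -- The sample form contributes `3 * lam * D`. The Gram error `ρ * D ^ 2` is made linear in `D` by
  -- `D ≤ 4 * B`, contributing the other `2 * lam * D`.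
  have h5 : κ * Q ≤ 5 * lam * D := by
    have e1 := hΓ Δ
    have e2 : ρ * D ^ 2 ≤ 2 * lam * D := by
      have : ρ * D ≤ 2 * lam := by
        have := mul_le_mul_of_nonneg_left hD4 hρ
        nlinarith
      nlinarith
    have e3 : lam * (A - A') ≤ lam * D := by gcongr
    linarith
  rcases hQ0.eq_or_lt with h0 | h0
  · rw [← h0, Real.sqrt_zero]; positivity
  have hr : 0 < √Q := Real.sqrt_pos.2 h0
  have hQQ : Q = √Q * √Q := (Real.mul_self_sqrt hQ0).symm
  have h6 : κ * (√Q * √Q) ≤ 20 * (√s * lam) * √Q := by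
    rw [← hQQ]
    have : 5 * lam * D ≤ 5 * lam * (4 * (√s * √Q)) := by gcongr; linarith
    linarith
  rw [← mul_assoc] at h6
  have h7 := le_of_mul_le_mul_right h6 hr
  rw [← mul_assoc, ← div_eq_mul_inv, le_div_iff₀ hκ]
  linarith

lemma lambdaMin_pos_and_le {m : Type*} [Fintype m] [DecidableEq m] [Nonempty m] {B : Matrix m m ℝ}
    (hB : B.PosDef) :
    0 < lambdaMin B ∧ ∀ v : m → ℝ, lambdaMin B * ∑ i, v i ^ 2 ≤ ∑ i, ∑ j, B i j * v i * v j := by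
  have hH := hB.1
  have hspec : spectrum ℝ B = Set.range hH.eigenvalues := hH.spectrum_real_eq_range_eigenvalues
  have hfin : (Set.range hH.eigenvalues).Finite := Set.finite_range _
  have hle : ∀ i, lambdaMin B ≤ hH.eigenvalues i := fun i => by
    unfold lambdaMin
    rw [hspec]
    exact csInf_le hfin.bddBelow ⟨i, rfl⟩
  constructor
  · have : lambdaMin B ∈ Set.range hH.eigenvalues := by
      unfold lambdaMin
      rw [hspec]
      exact (Set.range_nonempty _).csInf_mem hfin
    obtain ⟨i, hi⟩ := this
    rw [← hi]
    exact hB.eigenvalues_pos i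
  · intro v
    have hps : (B - lambdaMin B • (1 : Matrix m m ℝ)).PosSemidef := by
      have hs : (B - lambdaMin B • (1 : Matrix m m ℝ)).IsHermitian := by
        refine hH.sub ?_
        rw [Matrix.IsHermitian, Matrix.conjTranspose_smul]
        simp
      rw [hs.posSemidef_iff_eigenvalues_nonneg]
      intro i
      have hmem := hs.eigenvalues_mem_spectrum_real i
      have : hs.eigenvalues i + lambdaMin B ∈ spectrum ℝ B := by
        have e : B = algebraMap ℝ _ (lambdaMin B) + (B - lambdaMin B • (1 : Matrix m m ℝ)) := by
          rw [Algebra.algebraMap_eq_smul_one]; abel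
        have h1 := spectrum.add_mem_add_iff (s := lambdaMin B).2 hmem
        rwa [← e] at h1
      rw [hspec] at this
      obtain ⟨k, hk⟩ := this
      have := hle k
      change 0 ≤ _
      linarith
    have := hps.dotProduct_mulVec_nonneg v
    simp only [star_trivial, Matrix.sub_mulVec, Matrix.smul_mulVec, Matrix.one_mulVec,
      dotProduct_sub, dotProduct_smul, smul_eq_mul, sub_nonneg] at this
    refine le_trans (le_of_eq ?_) (this.trans (le_of_eq ?_))
    · simp only [dotProduct, sq]
    · simp only [dotProduct, Matrix.mulVec, Finset.mul_sum]
      refine Finset.sum_congr rfl fun _ _ => Finset.sum_congr rfl fun _ _ => ?_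
      ring

end Lasso

/-! ### Measurability of the positive semidefinite square root. -/

section SquareRoot

open scoped MatrixOrder in
lemma posSemidef_mul_self_injOn (N : ℕ) {S S' : Matrix (Fin N) (Fin N) ℝ} (hS : S.PosSemidef)
    (hS' : S'.PosSemidef) (h : S * S = S' * S') : S = S' :=
  (CFC.mul_self_eq_mul_self_iff S S' hS.nonneg hS'.nonneg).1 h

/-- The positive semidefinite square root is a Borel function. -/
lemma exists_measurable_sqrt (N : ℕ) :
    ∃ F : (Fin N → Fin N → ℝ) → Fin N → Fin N → ℝ, Measurable F ∧
      ∀ S : Matrix (Fin N) (Fin N) ℝ, S.PosSemidef →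
        F (fun i j => (S * S) i j) = fun i j => S i j := by
  set P : Set (Fin N → Fin N → ℝ) := {S | (Matrix.of S).PosSemidef} with hP
  have hclosed : IsClosed P := by
    have : P = {S | ∀ i j, S j i = S i j} ∩ {S | ∀ x : Fin N → ℝ, 0 ≤ ∑ i, x i * ∑ j, S i j * x j} := by
      ext S
      simp only [hP, Matrix.posSemidef_iff_dotProduct_mulVec]
      constructor
      · rintro ⟨h1, h2⟩
        refine ⟨fun i j => ?_, fun x => ?_⟩
        · simpa using h1.apply i j
        · simpa [dotProduct, Matrix.mulVec] using h2 x
      · rintro ⟨h1, h2⟩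
        refine ⟨?_, fun x => ?_⟩
        · ext i j; simpa using h1 i j
        · simpa [dotProduct, Matrix.mulVec] using h2 x
    rw [this]
    refine IsClosed.inter ?_ ?_
    · simp only [Set.ofPred_forall]
      exact isClosed_iInter fun i => isClosed_iInter fun j =>
        isClosed_eq (by fun_prop) (by fun_prop)
    · simp only [Set.ofPred_forall]
      exact isClosed_iInter fun x => isClosed_le (by fun_prop) (by fun_prop)
  set sq : (Fin N → Fin N → ℝ) → Fin N → Fin N → ℝ := fun S i j => ∑ k, S i k * S k j with hsq
  have hcont : Continuous sq := by
    refine continuous_pi fun i => continuous_pi fun j => ?_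
    exact continuous_finsetSum _ fun k _ => by fun_prop
  have hinj : Set.InjOn sq P := fun S hS S' hS' h => by
    refine Matrix.of.injective (posSemidef_mul_self_injOn N hS hS' ?_)
    ext i j
    exact congrFun (congrFun h i) j
  -- Lusin–Souslin: squaring is continuous and injective on the closed cone, hence a measurable
  -- embedding with Borel inverse.
  have hemb := hcont.continuousOn.measurableEmbedding hclosed.measurableSet hinj
  refine ⟨Function.extend (P.domRestrict sq) Subtype.val 0,
    hemb.measurable_extend measurable_subtype_coe measurable_zero, fun S hS => ?_⟩
  exact hemb.injective.extend_apply Subtype.val 0 ⟨fun i j => S i j, hS⟩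

end SquareRoot

/-! ### Vectorization of the covariance recursion. -/

section Duplication

variable {N : ℕ}

lemma dupMatrix_mulVec_vech {B : Matrix (Fin N) (Fin N) ℝ} (hB : ∀ i j, B i j = B j i) :
    dupMatrix N *ᵥ vech B = fun a => B a.1 a.2 := by
  ext a
  simp only [Matrix.mulVec, dotProduct, dupMatrix, vech, ite_mul, one_mul, zero_mul]
  obtain ⟨i, j⟩ := a
  rcases le_total j i with h | h
  · rw [Finset.sum_eq_single (⟨(i, j), h⟩ : VechIdx N)]
    · simp
    · rintro ⟨⟨k, l⟩, hkl⟩ - hne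
      rw [if_neg]
      simp only [Prod.mk.injEq, Prod.swap_prod_mk, not_or, ne_eq, Subtype.mk.injEq] at hne ⊢ hkl
      grind
    · simp
  · rw [Finset.sum_eq_single (⟨(j, i), h⟩ : VechIdx N)]
    · simp [hB j i]
    · rintro ⟨⟨k, l⟩, hkl⟩ - hne
      rw [if_neg]
      simp only [Prod.mk.injEq, Prod.swap_prod_mk, not_or, ne_eq, Subtype.mk.injEq] at hne ⊢ hkl
      grind
    · simp

/-- Distinct columns of the duplication matrix have disjoint supports, so its Gram matrix is
diagonal with positive entries. -/
lemma elimMatrix_mul_dupMatrix (N : ℕ) : elimMatrix N * dupMatrix N = 1 := by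
  have hdiag : (dupMatrix N)ᵀ * dupMatrix N = Matrix.diagonal fun q => ∑ a, dupMatrix N a q := by
    ext q q'
    rw [Matrix.mul_apply, Matrix.diagonal_apply]
    obtain ⟨⟨k, l⟩, hkl⟩ := q
    obtain ⟨⟨k', l'⟩, hkl'⟩ := q'
    split_ifs with h
    · rw [← h]
      refine Finset.sum_congr rfl fun a _ => ?_
      simp only [Matrix.transpose_apply, dupMatrix]
      split_ifs <;> simp
    · refine Finset.sum_eq_zero fun a _ => ?_
      obtain ⟨i, j⟩ := a
      simp only [Matrix.transpose_apply, dupMatrix, Prod.mk.injEq, Prod.swap_prod_mk,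
        Subtype.mk.injEq, mul_ite, mul_one, mul_zero] at h ⊢ hkl hkl'
      grind
  have hunit : IsUnit ((dupMatrix N)ᵀ * dupMatrix N).det := by
    rw [hdiag, Matrix.det_diagonal, isUnit_iff_ne_zero, Finset.prod_ne_zero_iff]
    intro q _
    have : (0 : ℝ) < ∑ a, dupMatrix N a q := by
      refine Finset.sum_pos' (fun a _ => ?_) ⟨q.1, Finset.mem_univ _, ?_⟩
      · simp only [dupMatrix]; split_ifs <;> norm_num
      · simp [dupMatrix]
    exact this.ne'
  rw [elimMatrix, Matrix.mul_assoc, Matrix.nonsing_inv_mul _ hunit]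

lemma elimMatrix_mulVec {C : Matrix (Fin N) (Fin N) ℝ} (hC : ∀ i j, C i j = C j i) :
    elimMatrix N *ᵥ (fun a => C a.1 a.2) = vech C := by
  rw [← dupMatrix_mulVec_vech hC, Matrix.mulVec_mulVec, elimMatrix_mul_dupMatrix,
    Matrix.one_mulVec]

lemma kronecker_mulVec (A B : Matrix (Fin N) (Fin N) ℝ) :
    (A ⊗ₖ A) *ᵥ (fun a => B a.1 a.2) = fun a => (A * B * Aᵀ) a.1 a.2 := by
  ext ⟨i, j⟩
  simp only [Matrix.mulVec, dotProduct, Matrix.kroneckerMap_apply, Matrix.mul_apply,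
    Matrix.transpose_apply, Fintype.sum_prod_type, Finset.sum_mul]
  rw [Finset.sum_comm]
  refine Finset.sum_congr rfl fun _ _ => Finset.sum_congr rfl fun _ _ => ?_
  ring

/-- The vectorized form of the conditional covariance recursion. -/
lemma condCov_apply_eq {p : ℕ} {K : Fin p → ℕ} (Om : Matrix (Fin N) (Fin N) ℝ)
    (A : (i : Fin p) → Fin (K i) → Matrix (Fin N) (Fin N) ℝ) (path : ℤ → Fin N → ℝ) (t : ℤ)
    (q : VechIdx N) :
    condCov Om A path t q.1.1 q.1.2 = ∑ c, thetaStar Om A c q * xVec p path t c := by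
  have hsymm : ∀ (u : Fin N → ℝ) i j, Matrix.vecMulVec u u i j = Matrix.vecMulVec u u j i :=
    fun u i j => by simp [Matrix.vecMulVec_apply, mul_comm]
  rw [Fintype.sum_option, Fintype.sum_prod_type]
  simp only [thetaStar, xVec, mul_one, condCov, Matrix.add_apply, Matrix.sum_apply]
  congr 1
  refine Finset.sum_congr rfl fun i _ => ?_
  set u := path (t - ((i : ℕ) + 1))
  set B := Matrix.vecMulVec u u with hB
  have h1 : ∑ q', Phi A i q q' * yVec path (t - ((i : ℕ) + 1)) q' = (Phi A i *ᵥ vech B) q := rfl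
  have hC : ∀ k l, (∑ k, A i k * B * (A i k)ᵀ) k l = (∑ k, A i k * B * (A i k)ᵀ) l k := by
    intro k l
    have hT : (∑ k, A i k * B * (A i k)ᵀ)ᵀ = ∑ k, A i k * B * (A i k)ᵀ := by
      rw [Matrix.transpose_sum]
      refine Finset.sum_congr rfl fun k _ => ?_
      have : Bᵀ = B := by ext a b; exact hsymm u b a
      rw [Matrix.transpose_mul, Matrix.transpose_mul, Matrix.transpose_transpose, this,
        Matrix.mul_assoc]
    exact (congrFun (congrFun hT l) k)
  have h2 : (∑ k, A i k ⊗ₖ A i k) *ᵥ (fun a => B a.1 a.2) =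
      fun a => (∑ k, A i k * B * (A i k)ᵀ) a.1 a.2 := by
    rw [Matrix.sum_mulVec]
    simp_rw [kronecker_mulVec]
    ext a
    simp [Matrix.sum_apply]
  rw [h1, Phi, ← Matrix.mulVec_mulVec, dupMatrix_mulVec_vech (hsymm u), ← Matrix.mulVec_mulVec,
    h2, elimMatrix_mulVec hC, vech, Matrix.sum_apply]

end Duplication

/-! ### Conditional second moments of the process. -/

section ConditionalMoments

variable {Ω : Type*} {N p : ℕ} {K : Fin p → ℕ} {Om : Matrix (Fin N) (Fin N) ℝ}
  {A : (i : Fin p) → Fin (K i) → Matrix (Fin N) (Fin N) ℝ} {r η : ℤ → Ω → Fin N → ℝ}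

lemma measurable_condCov (Om : Matrix (Fin N) (Fin N) ℝ)
    (A : (i : Fin p) → Fin (K i) → Matrix (Fin N) (Fin N) ℝ) (r : ℤ → Ω → Fin N → ℝ) (t : ℤ)
    (i j : Fin N) :
    Measurable[pastSigma r (t - 1)] fun ω => condCov Om A (fun u => r u ω) t i j := by
  have hr : ∀ (l : Fin p) (k : Fin N),
      Measurable[pastSigma r (t - 1)] fun ω => r (t - ((l : ℕ) + 1)) ω k := fun l k =>
    (measurable_pi_apply k).comp (measurable_pastSigma r (by omega))
  simp only [condCov, Matrix.add_apply, Matrix.sum_apply, Matrix.mul_apply,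
    Matrix.vecMulVec_apply, Matrix.transpose_apply]
  refine measurable_const.add (Finset.measurable_sum _ fun l _ =>
    Finset.measurable_sum _ fun k _ => Finset.measurable_sum _ fun a _ => ?_)
  refine Measurable.mul_const (Finset.measurable_sum _ fun b _ => ?_) _
  exact measurable_const.mul ((hr l b).mul (hr l a))

/-- The matrix `Σ_t` is the conditional second moment of `r_t` given the past. -/
lemma IsBEKKARCH.integral_mul_mul [MeasurableSpace Ω] {μ : Measure Ω} [IsProbabilityMeasure μ]
    (h : IsBEKKARCH μ Om A r η) (t : ℤ) {Z : Ω → ℝ}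
    (hZ : Measurable[pastSigma r (t - 1)] Z)
    (hZV : ∀ i, Integrable (fun ω => Z ω * condCov Om A (fun u => r u ω) t i i) μ)
    (i j : Fin N) :
    ∫ ω, Z ω * (r t ω i * r t ω j) ∂μ =
      ∫ ω, Z ω * condCov Om A (fun u => r u ω) t i j ∂μ := by
  obtain ⟨F, hF, hFS⟩ := exists_measurable_sqrt N
  have hle := pastSigma_le h.measurable_r (t - 1)
  set V : Ω → Fin N → Fin N → ℝ := fun ω i j => condCov Om A (fun u => r u ω) t i j with hV
  have hVm : Measurable[pastSigma r (t - 1)] V := by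
    refine @measurable_pi_lambda _ _ _ (pastSigma r (t - 1)) _ _ fun i => ?_
    exact @measurable_pi_lambda _ _ _ (pastSigma r (t - 1)) _ _ fun j =>
      measurable_condCov Om A r t i j
  set S : Ω → Fin N → Fin N → ℝ := fun ω => F (V ω) with hS
  have hSm : ∀ i j, Measurable[pastSigma r (t - 1)] fun ω => S ω i j := fun i j =>
    (measurable_pi_apply j).comp ((measurable_pi_apply i).comp (hF.comp hVm))
  -- The model only asserts that some root exists for almost every `ω`; uniqueness identifies it
  -- with `F (V ω)`, which is measurable with respect to the past and hence independent of `η t`.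
  have hae : ∀ᵐ ω ∂μ, (∀ i j, S ω i j = S ω j i) ∧ (∀ i j, ∑ k, S ω i k * S ω k j = V ω i j) ∧
      ∀ i, r t ω i = ∑ k, S ω i k * η t ω k := by
    filter_upwards [h.eqn t] with ω hω
    obtain ⟨R, hR, hRR, hrR⟩ := hω
    have hSR : S ω = fun i j => R i j := by
      rw [← hFS R hR, hRR]
    simp only [hSR]
    refine ⟨fun i j => ?_, fun i j => ?_, fun i => ?_⟩
    · simpa using hR.1.apply j i
    · simp only [hV, ← hRR, Matrix.mul_apply]
    · rw [hrR]; rfl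
  -- A squared entry of the root is at most a diagonal entry of `V`, so integrability of `Z` times
  -- the diagonal suffices. Independence then makes the products with `η` integrable.
  have hbound : ∀ k l i j, ∀ᵐ ω ∂μ, |Z ω * (S ω i k * S ω j l)| ≤
      |Z ω * V ω i i| + |Z ω * V ω j j| := fun k l i j => by
    filter_upwards [hae] with ω ⟨h1, h2, _⟩
    have hd : ∀ i k, S ω i k ^ 2 ≤ V ω i i := fun i k => by
      rw [← h2 i i]
      calc S ω i k ^ 2 = S ω i k * S ω k i := by rw [h1 k i, sq]
        _ ≤ _ := Finset.single_le_sum (f := fun k => S ω i k * S ω k i)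
          (fun k _ => by rw [h1 k i]; exact mul_self_nonneg _) (Finset.mem_univ k)
    have e1 := hd i k
    have e2 := hd j l
    have e3 : |S ω i k * S ω j l| ≤ |V ω i i| + |V ω j j| := by
      have := le_abs_self (V ω i i)
      have := le_abs_self (V ω j j)
      rw [abs_le]
      constructor <;> nlinarith [sq_nonneg (S ω i k + S ω j l), sq_nonneg (S ω i k - S ω j l)]
    rw [abs_mul, abs_mul (Z ω) (V ω i i), abs_mul (Z ω) (V ω j j), ← mul_add]
    exact mul_le_mul_of_nonneg_left e3 (abs_nonneg _)
  have hUm : ∀ k l i j, Measurable[pastSigma r (t - 1)] fun ω => Z ω * (S ω i k * S ω j l) :=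
    fun k l i j => hZ.mul ((hSm i k).mul (hSm j l))
  have hUi : ∀ k l i j, Integrable (fun ω => Z ω * (S ω i k * S ω j l)) μ := fun k l i j =>
    Integrable.mono' ((hZV i).abs.add (hZV j).abs)
      ((hUm k l i j).mono hle le_rfl).aestronglyMeasurable (hbound k l i j)
  have hηi : ∀ k l, Integrable (fun ω => η t ω k * η t ω l) μ := fun k l =>
    (h.memLp t k).integrable_mul (h.memLp t l)
  have hηm : ∀ k l, Measurable[MeasurableSpace.comap (η t) inferInstance]
      fun ω => η t ω k * η t ω l := fun k l =>
    Measurable.comp (g := fun v : Fin N → ℝ => v k * v l)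
      ((measurable_pi_apply k).mul (measurable_pi_apply l)) (comap_measurable (η t))
  have hind : ∀ k l, IndepFun (fun ω => Z ω * (S ω i k * S ω j l))
      (fun ω => η t ω k * η t ω l) μ := fun k l =>
    (indep_of_indep_of_le (h.indep_past t) (hηm k l).comap_le (hUm k l i j).comap_le).symm
  have hprodi : ∀ k l, Integrable
      (fun ω => Z ω * (S ω i k * S ω j l) * (η t ω k * η t ω l)) μ := fun k l =>
    (hind k l).integrable_mul (hUi k l i j) (hηi k l)
  have hprod : ∀ k l, ∫ ω, Z ω * (S ω i k * S ω j l) * (η t ω k * η t ω l) ∂μ =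
      if k = l then ∫ ω, Z ω * (S ω i k * S ω j l) ∂μ else 0 := fun k l => by
    rw [(hind k l).integral_fun_mul_eq_mul_integral (hUi k l i j).1 (hηi k l).1, h.cov]
    split_ifs <;> simp
  calc ∫ ω, Z ω * (r t ω i * r t ω j) ∂μ
      = ∫ ω, ∑ k, ∑ l, Z ω * (S ω i k * S ω j l) * (η t ω k * η t ω l) ∂μ := by
        refine integral_congr_ae ?_
        filter_upwards [hae] with ω ⟨_, _, h3⟩
        rw [h3 i, h3 j, Finset.sum_mul_sum, Finset.mul_sum]
        refine Finset.sum_congr rfl fun k _ => ?_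
        rw [Finset.mul_sum]
        exact Finset.sum_congr rfl fun l _ => by ring
    _ = ∑ k, ∑ l, ∫ ω, Z ω * (S ω i k * S ω j l) * (η t ω k * η t ω l) ∂μ := by
        rw [integral_finsetSum _ fun k _ => integrable_finsetSum _ fun l _ => hprodi k l]
        exact Finset.sum_congr rfl fun k _ => integral_finsetSum _ fun l _ => hprodi k l
    _ = ∑ k, ∫ ω, Z ω * (S ω i k * S ω j k) ∂μ := by simp_rw [hprod]; simp
    _ = ∫ ω, ∑ k, Z ω * (S ω i k * S ω j k) ∂μ :=
        (integral_finsetSum _ fun k _ => hUi k k i j).symm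
    _ = ∫ ω, Z ω * condCov Om A (fun u => r u ω) t i j ∂μ := by
        refine integral_congr_ae ?_
        filter_upwards [hae] with ω ⟨h1, h2, _⟩
        rw [← Finset.mul_sum]
        congr 1
        refine Eq.trans ?_ (h2 i j)
        exact Finset.sum_congr rfl fun k _ => by rw [h1 j k]

end ConditionalMoments

/-! ### Products of four numbers and their truncations. -/

section Products

variable {w v : Fin 4 → ℝ} {ε τ : ℝ}

lemma exists_abs_prod_le (w : Fin 4 → ℝ) :
    ∃ k, (∀ l, |w l| ≤ |w k|) ∧ |∏ l, w l| ≤ |w k| ^ 4 := by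
  obtain ⟨k, hk⟩ := Finite.exists_max fun l => |w l|
  refine ⟨k, hk, ?_⟩
  rw [Finset.abs_prod]
  refine (Finset.prod_le_prod (fun _ _ => abs_nonneg _) fun l _ => hk l).trans_eq ?_
  simp

lemma pow_four_rpow {x : ℝ} (hx : 0 ≤ x) (ε : ℝ) :
    (x ^ 4) ^ (1 + ε) = x ^ (4 + 4 * ε) := by
  rw [← Real.rpow_natCast, ← Real.rpow_mul hx]
  congr 1; push_cast; ring

lemma abs_prod_rpow_le (hε : 0 < ε) (w : Fin 4 → ℝ) :
    |∏ l, w l| ^ (1 + ε) ≤ ∑ l, |w l| ^ (4 + 4 * ε) := by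
  obtain ⟨k, -, hk⟩ := exists_abs_prod_le w
  refine (Real.rpow_le_rpow (abs_nonneg _) hk (by linarith)).trans ?_
  rw [pow_four_rpow (abs_nonneg _) ε]
  exact Finset.single_le_sum (f := fun l => |w l| ^ (4 + 4 * ε))
    (fun l _ => by positivity) (Finset.mem_univ k)

lemma abs_prod_le_one_add (hε : 0 < ε) (w : Fin 4 → ℝ) :
    |∏ l, w l| ≤ 1 + ∑ l, |w l| ^ (4 + 4 * ε) := by
  have h := abs_prod_rpow_le hε w
  rcases le_total |∏ l, w l| 1 with h1 | h1
  · have : 0 ≤ ∑ l, |w l| ^ (4 + 4 * ε) := Finset.sum_nonneg fun _ _ => by positivity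
    linarith
  · have := Real.rpow_le_rpow_of_exponent_le h1 (show (1 : ℝ) ≤ 1 + ε by linarith)
    rw [Real.rpow_one] at this
    linarith

/-- If any factor changes, the largest `|w k|` is at least `τ`. Both products are then at most `|w
k| ^ 4`, which the excess over `τ` trades for `τ ^ (-(4 * ε)) * |w k| ^ (4 + 4 * ε)`. -/
lemma abs_prod_sub_prod_le (hε : 0 < ε) (hτ : 0 < τ) (hvw : ∀ l, |v l| ≤ |w l|)
    (h : ∀ l, v l = w l ∨ τ ≤ |w l|) :
    |∏ l, v l - ∏ l, w l| ≤ 2 * τ ^ (-(4 * ε)) * ∑ l, |w l| ^ (4 + 4 * ε) := by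
  by_cases hall : ∀ l, v l = w l
  · rw [funext hall, sub_self, abs_zero]
    exact mul_nonneg (by positivity) (Finset.sum_nonneg fun _ _ => by positivity)
  push Not at hall
  obtain ⟨l, hl⟩ := hall
  obtain ⟨k, hk, hp⟩ := exists_abs_prod_le w
  have hτk : τ ≤ |w k| := ((h l).resolve_left hl).trans (hk l)
  have hpv : |∏ l, v l| ≤ |w k| ^ 4 := by
    refine le_trans ?_ hp
    rw [Finset.abs_prod, Finset.abs_prod]
    exact Finset.prod_le_prod (fun _ _ => abs_nonneg _) fun l _ => hvw l
  have h1 : |w k| ^ 4 ≤ τ ^ (-(4 * ε)) * |w k| ^ (4 + 4 * ε) := by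
    have hw0 : 0 < |w k| := hτ.trans_le hτk
    rw [Real.rpow_neg hτ.le, Real.rpow_add hw0, ← div_eq_inv_mul, le_div_iff₀ (by positivity)]
    have : τ ^ (4 * ε) ≤ |w k| ^ (4 * ε) := Real.rpow_le_rpow hτ.le hτk (by positivity)
    calc |w k| ^ 4 * τ ^ (4 * ε) ≤ |w k| ^ 4 * |w k| ^ (4 * ε) := by gcongr
      _ = _ := by norm_cast
  have h2 : |w k| ^ (4 + 4 * ε) ≤ ∑ l, |w l| ^ (4 + 4 * ε) :=
    Finset.single_le_sum (f := fun l => |w l| ^ (4 + 4 * ε))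
      (fun l _ => by positivity) (Finset.mem_univ k)
  calc |∏ l, v l - ∏ l, w l| ≤ |∏ l, v l| + |∏ l, w l| := abs_sub _ _
    _ ≤ 2 * (τ ^ (-(4 * ε)) * |w k| ^ (4 + 4 * ε)) := by linarith
    _ ≤ 2 * (τ ^ (-(4 * ε)) * ∑ l, |w l| ^ (4 + 4 * ε)) := by gcongr
    _ = _ := by ring

end Products

/-! ### Moments of path monomials and the bias of truncation. -/

section Monomials

variable {N : ℕ}

/-- The coordinate `r_{t-l,i}` of a path, or the constant `1`. -/
def pathCoord (path : ℤ → Fin N → ℝ) (t : ℤ) : Option (ℕ × Fin N) → ℝ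
  | none => 1
  | some (l, i) => path (t - l) i

/-- The product of four path coordinates. -/
def pathMonomial (path : ℤ → Fin N → ℝ) (t : ℤ) (a : Fin 4 → Option (ℕ × Fin N)) : ℝ :=
  ∏ k, pathCoord path t (a k)

lemma truncPath_abs_le {τ : ℝ} (hτ : 0 ≤ τ) (path : ℤ → Fin N → ℝ) (t : ℤ) (i : Fin N) :
    |truncPath τ path t i| ≤ |path t i| ∧ |truncPath τ path t i| ≤ τ ∧
      (truncPath τ path t i = path t i ∨ τ ≤ |path t i|) := by
  unfold truncPath
  have h0 : 0 ≤ min |path t i| τ := le_min (abs_nonneg _) hτ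
  have h1 : |Real.sign (path t i) * min |path t i| τ| ≤ min |path t i| τ := by
    rw [abs_mul, abs_of_nonneg h0]
    refine mul_le_of_le_one_left h0 ?_
    rcases Real.sign_apply_eq (path t i) with h | h | h <;> simp [h]
  refine ⟨h1.trans (min_le_left _ _), h1.trans (min_le_right _ _), ?_⟩
  rcases le_total |path t i| τ with h | h
  · left; rw [min_eq_left h]
    rcases lt_trichotomy (path t i) 0 with h | h | h
    · rw [Real.sign_of_neg h, abs_of_neg h]; ring
    · simp [h]
    · rw [Real.sign_of_pos h, abs_of_pos h]; ring
  · exact Or.inr h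

/-- The constant coordinate is never truncated, whence `max 1 τ` instead of `τ`. -/
lemma pathCoord_trunc {τ : ℝ} (hτ : 0 ≤ τ) (path : ℤ → Fin N → ℝ) (t : ℤ)
    (c : Option (ℕ × Fin N)) :
    |pathCoord (truncPath τ path) t c| ≤ |pathCoord path t c| ∧
      |pathCoord (truncPath τ path) t c| ≤ max 1 τ ∧
      (pathCoord (truncPath τ path) t c = pathCoord path t c ∨ τ ≤ |pathCoord path t c|) := by
  rcases c with _ | ⟨l, i⟩
  · simp [pathCoord]
  · have := truncPath_abs_le hτ path (t - l) i
    exact ⟨this.1, this.2.1.trans (le_max_right _ _), this.2.2⟩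

lemma abs_pathMonomial_trunc_le {τ : ℝ} (hτ : 0 ≤ τ) (path : ℤ → Fin N → ℝ) (t : ℤ)
    (a : Fin 4 → Option (ℕ × Fin N)) :
    |pathMonomial (truncPath τ path) t a| ≤ max 1 τ ^ 4 := by
  unfold pathMonomial
  rw [Finset.abs_prod]
  refine (Finset.prod_le_prod (fun _ _ => abs_nonneg _) fun l _ =>
    (pathCoord_trunc hτ path t (a l)).2.1).trans_eq ?_
  simp

lemma measurable_truncPath (τ : ℝ) : Measurable fun x : ℝ => Real.sign x * min |x| τ := by
  have hs : Measurable Real.sign := by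
    have : Real.sign = fun x : ℝ => if x < 0 then -1 else if 0 < x then 1 else 0 := rfl
    rw [this]
    exact Measurable.ite measurableSet_Iio measurable_const
      (Measurable.ite measurableSet_Ioi measurable_const measurable_const)
  exact hs.mul (measurable_id.abs.min measurable_const)

variable {Ω : Type*} {r : ℤ → Ω → Fin N → ℝ}

lemma measurable_pathMonomial {m : MeasurableSpace Ω} {t : ℤ} {a : Fin 4 → Option (ℕ × Fin N)}
    (h : ∀ k l i, a k = some (l, i) → Measurable[m] (r (t - l))) (τ : ℝ) :
    Measurable[m] (fun ω => pathMonomial (fun u => r u ω) t a) ∧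
    Measurable[m] (fun ω => pathMonomial (truncPath τ fun u => r u ω) t a) := by
  unfold pathMonomial
  constructor
  · refine Finset.measurable_prod _ fun k _ => ?_
    rcases hk : a k with _ | ⟨l, i⟩
    · exact measurable_const
    · exact (measurable_pi_apply i).comp (h k l i hk)
  · refine Finset.measurable_prod _ fun k _ => ?_
    rcases hk : a k with _ | ⟨l, i⟩
    · exact measurable_const
    · exact (measurable_truncPath τ).comp ((measurable_pi_apply i).comp (h k l i hk))

variable [MeasurableSpace Ω] {μ : Measure Ω} [IsProbabilityMeasure μ] {ε M : ℝ}

lemma integral_sum_pathCoord_le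
    (hmom : ∀ t j, Integrable (fun ω => |r t ω j| ^ (4 + 4 * ε)) μ ∧
      ∫ ω, |r t ω j| ^ (4 + 4 * ε) ∂μ ≤ M) (hM : 1 ≤ M) (t : ℤ)
    (a : Fin 4 → Option (ℕ × Fin N)) :
    Integrable (fun ω => ∑ k, |pathCoord (fun u => r u ω) t (a k)| ^ (4 + 4 * ε)) μ ∧
      ∫ ω, ∑ k, |pathCoord (fun u => r u ω) t (a k)| ^ (4 + 4 * ε) ∂μ ≤ 4 * M := by
  have h : ∀ c, Integrable (fun ω => |pathCoord (fun u => r u ω) t c| ^ (4 + 4 * ε)) μ ∧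
      ∫ ω, |pathCoord (fun u => r u ω) t c| ^ (4 + 4 * ε) ∂μ ≤ M := by
    rintro (_ | ⟨l, i⟩)
    · simp [pathCoord, hM]
    · exact hmom (t - l) i
  refine ⟨integrable_finsetSum _ fun k _ => (h (a k)).1, ?_⟩
  rw [integral_finsetSum _ fun k _ => (h (a k)).1]
  refine (Finset.sum_le_sum fun k _ => (h (a k)).2).trans_eq ?_
  simp

lemma pathMonomial_moments (hr : ∀ t, Measurable (r t)) (hε : 0 < ε)
    (hmom : ∀ t j, Integrable (fun ω => |r t ω j| ^ (4 + 4 * ε)) μ ∧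
      ∫ ω, |r t ω j| ^ (4 + 4 * ε) ∂μ ≤ M) (hM : 1 ≤ M) (t : ℤ)
    (a : Fin 4 → Option (ℕ × Fin N)) {τ : ℝ} (hτ : 0 < τ) :
    Integrable (fun ω => pathMonomial (fun u => r u ω) t a) μ ∧
    |∫ ω, pathMonomial (fun u => r u ω) t a ∂μ| ≤ 5 * M ∧
    Integrable (fun ω => |pathMonomial (truncPath τ fun u => r u ω) t a| ^ (1 + ε)) μ ∧
    ∫ ω, |pathMonomial (truncPath τ fun u => r u ω) t a| ^ (1 + ε) ∂μ ≤ 4 * M ∧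
    |∫ ω, pathMonomial (truncPath τ fun u => r u ω) t a ∂μ -
      ∫ ω, pathMonomial (fun u => r u ω) t a ∂μ| ≤ 8 * M * τ ^ (-(4 * ε)) := by
  obtain ⟨hi, hle⟩ := integral_sum_pathCoord_le hmom hM t a
  obtain ⟨hm1, hm2⟩ := measurable_pathMonomial (r := r) (t := t) (a := a)
    (fun k l i _ => hr (t - l)) τ
  have hI1 : Integrable (fun ω => 1 +
      ∑ k, |pathCoord (fun u => r u ω) t (a k)| ^ (4 + 4 * ε)) μ := (integrable_const 1).add hi
  have h1 : Integrable (fun ω => pathMonomial (fun u => r u ω) t a) μ :=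
    Integrable.mono' hI1 hm1.aestronglyMeasurable
      (ae_of_all _ fun ω => abs_prod_le_one_add hε _)
  have htr : ∀ ω, |pathMonomial (truncPath τ fun u => r u ω) t a| ^ (1 + ε) ≤
      ∑ k, |pathCoord (fun u => r u ω) t (a k)| ^ (4 + 4 * ε) := fun ω => by
    refine (Real.rpow_le_rpow (abs_nonneg _) ?_ (by linarith)).trans
      (abs_prod_rpow_le hε fun k => pathCoord (fun u => r u ω) t (a k))
    unfold pathMonomial
    rw [Finset.abs_prod, Finset.abs_prod]
    exact Finset.prod_le_prod (fun _ _ => abs_nonneg _) fun l _ =>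
      (pathCoord_trunc hτ.le _ t (a l)).1
  have h2 : Integrable (fun ω => |pathMonomial (truncPath τ fun u => r u ω) t a| ^ (1 + ε)) μ := by
    refine Integrable.mono' hi (hm2.abs.pow_const _).aestronglyMeasurable (ae_of_all _ fun ω => ?_)
    rw [Real.norm_eq_abs, abs_of_nonneg (by positivity)]
    exact htr ω
  have h3 : Integrable (fun ω => pathMonomial (truncPath τ fun u => r u ω) t a) μ :=
    Integrable.of_bound hm2.aestronglyMeasurable (max 1 τ ^ 4)
      (ae_of_all _ fun ω => abs_pathMonomial_trunc_le hτ.le _ t a)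
  refine ⟨h1, ?_, h2, (integral_mono h2 hi htr).trans hle, ?_⟩
  · refine (abs_integral_le_integral_abs).trans ((integral_mono h1.abs hI1 fun ω =>
      abs_prod_le_one_add hε _).trans ?_)
    rw [integral_add (integrable_const 1) hi]
    simp only [integral_const, probReal_univ, smul_eq_mul, one_mul]
    linarith
  · rw [← integral_sub h3 h1]
    refine (abs_integral_le_integral_abs).trans ((integral_mono (h3.sub h1).abs
      (hi.const_mul (2 * τ ^ (-(4 * ε)))) fun ω => abs_prod_sub_prod_le hε hτ
        (fun l => (pathCoord_trunc hτ.le _ t (a l)).1)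
        (fun l => (pathCoord_trunc hτ.le _ t (a l)).2.2)).trans ?_)
    rw [integral_const_mul]
    have : 0 ≤ τ ^ (-(4 * ε)) := by positivity
    nlinarith

end Monomials

/-! ### Tail bound for bounded variables with `1 + ε` moments. -/

section Deviation

variable {Ω E : Type*} [MeasurableSpace Ω] [MeasurableSpace E]

lemma integral_exp_le_exp_of_abs_le_one {μ : Measure Ω} [IsProbabilityMeasure μ] {X : Ω → ℝ}
    (hX : Measurable X) (h1 : ∀ ω, |X ω| ≤ 1) (h0 : ∫ ω, X ω ∂μ = 0) {a : ℝ}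
    (ha : ∫ ω, X ω ^ 2 ∂μ ≤ a) : ∫ ω, Real.exp (X ω) ∂μ ≤ Real.exp a := by
  have hi : Integrable X μ := Integrable.of_bound hX.aestronglyMeasurable 1 (ae_of_all _ h1)
  have hi2 : Integrable (fun ω => X ω ^ 2) μ :=
    Integrable.of_bound (hX.pow_const 2).aestronglyMeasurable 1 (ae_of_all _ fun ω => by
      rw [Real.norm_eq_abs, abs_pow]; exact pow_le_one₀ (abs_nonneg _) (h1 ω))
  have hi3 : Integrable (fun ω => 1 + X ω) μ := (integrable_const 1).add hi
  calc ∫ ω, Real.exp (X ω) ∂μ ≤ ∫ ω, (1 + X ω + X ω ^ 2) ∂μ := by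
        refine integral_mono_of_nonneg (ae_of_all _ fun ω => (Real.exp_pos _).le)
          (hi3.add hi2) (ae_of_all _ fun ω => ?_)
        have := (abs_le.1 (Real.abs_exp_sub_one_sub_id_le (h1 ω))).2
        dsimp only
        linarith
    _ = 1 + ∫ ω, X ω ^ 2 ∂μ := by
        rw [integral_add hi3 hi2, integral_add (integrable_const 1) hi, h0]; simp
    _ ≤ Real.exp a := by have := Real.add_one_le_exp a; linarith

/-- Two-sided tail bound for sums of a bounded process with `1 + ε` moments. -/
lemma measure_abs_sum_sub_ge_le {μ : Measure Ω} [IsProbabilityMeasure μ] {r : ℤ → Ω → E}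
    (hr : ∀ t, Measurable (r t)) {p G T : ℕ} (hG : 1 ≤ G) (hT : 2 ≤ T) {ζ C : ℝ} (hζ : 0 ≤ ζ)
    (hζG : ζ ^ G ≤ Real.exp (-2)) (hC : 0 ≤ C)
    (hα : ∀ l : ℕ, 1 ≤ l → alphaMixing μ r l ≤ C * ζ ^ l) {Z : ℤ → Ω → ℝ}
    (hZp : ∀ t, Measurable[pastSigma r t] (Z t))
    (hZf : ∀ t, Measurable[futureSigma r (t - p)] (Z t)) {b : ℝ} (hb : 0 < b)
    (hZ : ∀ t ω, |Z t ω| ≤ b) {ε M : ℝ} (hε1 : ε ≤ 1) (hM : 0 ≤ M)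
    (hmi : ∀ t, Integrable (fun ω => |Z t ω| ^ (1 + ε)) μ)
    (hm : ∀ t, ∫ ω, |Z t ω| ^ (1 + ε) ∂μ ≤ 4 * M) {y : ℝ} (hy : 0 ≤ y) :
    μ.real {ω | 2 * b * y ≤ |∑ t ∈ Finset.Ioc (0 : ℤ) T, (Z t ω - ∫ ω', Z t ω' ∂μ)|} ≤
      2 * Real.exp (-(y / ((2 + 6 * G + 2 * p) * Real.log T)) +
        (T * (M * b ^ (-(1 + ε))) + C) / Real.log T) := by
  have hZm : ∀ t, Measurable (Z t) := fun t => (hZp t).mono (pastSigma_le hr t) le_rfl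
  have hZi : ∀ t, Integrable (Z t) μ := fun t =>
    Integrable.of_bound (hZm t).aestronglyMeasurable b (ae_of_all _ (hZ t))
  have hEb : ∀ t, |∫ ω, Z t ω ∂μ| ≤ b := fun t => by
    have := norm_integral_le_of_norm_le_const (μ := μ) (f := Z t) (C := b) (ae_of_all _ (hZ t))
    simpa using this
  have hZ2i : ∀ t, Integrable (fun ω => Z t ω ^ 2) μ := fun t =>
    Integrable.of_bound ((hZm t).pow_const 2).aestronglyMeasurable (b ^ 2)
      (ae_of_all _ fun ω => by
        rw [Real.norm_eq_abs, abs_pow]; exact pow_le_pow_left₀ (abs_nonneg _) (hZ t ω) 2)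
  -- Interpolation between the bound `b` and the moment of order `1 + ε`. After division by `4 * b ^
  -- 2` this becomes the variance proxy `M * b ^ (-(1 + ε))`.
  have hZ2 : ∀ t, ∫ ω, Z t ω ^ 2 ∂μ ≤ 4 * M * b ^ (1 - ε) := fun t => by
    calc ∫ ω, Z t ω ^ 2 ∂μ ≤ ∫ ω, |Z t ω| ^ (1 + ε) * b ^ (1 - ε) ∂μ := by
          refine integral_mono (hZ2i t) ((hmi t).mul_const _) fun ω => ?_
          dsimp only
          rcases (abs_nonneg (Z t ω)).eq_or_lt with h0 | h0
          · have : Z t ω = 0 := abs_eq_zero.1 h0.symm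
            rw [this]
            simp only [ne_eq, OfNat.ofNat_ne_zero, not_false_eq_true, zero_pow]
            positivity
          · have e : Z t ω ^ 2 = |Z t ω| ^ (1 + ε) * |Z t ω| ^ (1 - ε) := by
              rw [← Real.rpow_add h0, ← sq_abs, ← Real.rpow_natCast]
              congr 1; push_cast; ring
            rw [e]
            exact mul_le_mul_of_nonneg_left
              (Real.rpow_le_rpow (abs_nonneg _) (hZ t ω) (by linarith)) (by positivity)
      _ = (∫ ω, |Z t ω| ^ (1 + ε) ∂μ) * b ^ (1 - ε) := integral_mul_const _ _
      _ ≤ 4 * M * b ^ (1 - ε) := by have := hm t; gcongr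
  have key : ∀ σ : ℝ, |σ| = 1 →
      μ.real {ω | y ≤ ∑ t ∈ Finset.Ioc (0 : ℤ) T, σ * (Z t ω - ∫ ω', Z t ω' ∂μ) / (2 * b)} ≤
      Real.exp (-(y / ((2 + 6 * G + 2 * p) * Real.log T)) +
        (T * (M * b ^ (-(1 + ε))) + C) / Real.log T) := fun σ hσ => by
    have hm' : ∀ {m : MeasurableSpace Ω} {t : ℤ}, Measurable[m] (Z t) →
        Measurable[m] fun ω => σ * (Z t ω - ∫ ω', Z t ω' ∂μ) / (2 * b) := fun h =>
      ((h.sub_const _).const_mul _).div_const _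
    have hb' : ∀ t ω, |σ * (Z t ω - ∫ ω', Z t ω' ∂μ) / (2 * b)| ≤ 1 := fun t ω => by
      rw [abs_div, abs_mul, hσ, one_mul, abs_of_pos (by positivity : 0 < 2 * b),
        div_le_one (by positivity)]
      refine (abs_sub _ _).trans ?_
      have := hZ t ω; have := hEb t
      linarith
    refine measure_sum_ge_le_of_alphaMixing (X := fun t ω =>
      σ * (Z t ω - ∫ ω', Z t ω' ∂μ) / (2 * b)) hr hG hT hζ hζG hC hα (fun t => hm' (hZp t))
      (fun t => hm' (hZf t)) hb' (fun t => integral_exp_le_exp_of_abs_le_one (hm' (hZm t)) (hb' t)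
        ?_ ?_) (by positivity) hy
    · rw [integral_div, integral_const_mul, integral_sub (hZi t) (integrable_const _)]
      simp
    · have hσ2 : σ ^ 2 = 1 := by rw [← sq_abs, hσ, one_pow]
      have e : ∀ ω, (σ * (Z t ω - ∫ ω', Z t ω' ∂μ) / (2 * b)) ^ 2 =
          (Z t ω ^ 2 - 2 * (∫ ω', Z t ω' ∂μ) * Z t ω + (∫ ω', Z t ω' ∂μ) ^ 2) / (4 * b ^ 2) :=
        fun ω => by rw [div_pow, mul_pow, hσ2]; ring
      simp_rw [e]
      have hi : Integrable (fun ω => Z t ω ^ 2 - 2 * (∫ ω', Z t ω' ∂μ) * Z t ω) μ :=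
        (hZ2i t).sub ((hZi t).const_mul _)
      rw [integral_div, integral_add hi (integrable_const _),
        integral_sub (hZ2i t) ((hZi t).const_mul _), integral_const_mul]
      simp only [integral_const, probReal_univ, smul_eq_mul, one_mul]
      rw [div_le_iff₀ (by positivity)]
      have e2 : M * b ^ (-(1 + ε)) * (4 * b ^ 2) = 4 * M * b ^ (1 - ε) := by
        have : b ^ (1 - ε) = b ^ (-(1 + ε)) * b ^ 2 := by
          rw [← Real.rpow_natCast b 2, ← Real.rpow_add hb]
          congr 1; push_cast; ring
        rw [this]; ring
      rw [e2]
      nlinarith [hZ2 t, sq_nonneg (∫ ω, Z t ω ∂μ)]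
  have hsub : {ω | 2 * b * y ≤ |∑ t ∈ Finset.Ioc (0 : ℤ) T, (Z t ω - ∫ ω', Z t ω' ∂μ)|} ⊆
      {ω | y ≤ ∑ t ∈ Finset.Ioc (0 : ℤ) T, 1 * (Z t ω - ∫ ω', Z t ω' ∂μ) / (2 * b)} ∪
      {ω | y ≤ ∑ t ∈ Finset.Ioc (0 : ℤ) T, (-1) * (Z t ω - ∫ ω', Z t ω' ∂μ) / (2 * b)} := by
    intro ω hω
    simp only [Set.mem_union, Set.mem_ofPred_eq, ← Finset.sum_div, ← Finset.mul_sum] at hω ⊢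
    rw [le_div_iff₀ (by positivity), le_div_iff₀ (by positivity)]
    rcases le_abs.1 hω with h | h
    · left; linarith
    · right; linarith
  refine (measureReal_mono hsub).trans ((measureReal_union_le _ _).trans ?_)
  have := key 1 (by simp)
  have := key (-1) (by simp)
  linarith

end Deviation

/-! ### Dimension counts and scales. -/

section Scales

lemma card_vechIdx (N : ℕ) : Fintype.card (VechIdx N) = vechDim N := by
  have h1 : Fintype.card (VechIdx N) = ∑ i : Fin N, ((i : ℕ) + 1) := by
    rw [Fintype.card_subtype, Finset.card_filter, Fintype.sum_prod_type]
    refine Finset.sum_congr rfl fun i _ => ?_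
    rw [← Finset.card_filter]
    have : (Finset.univ.filter fun j : Fin N => j ≤ i) = Finset.Iic i := by ext; simp
    rw [this, Fin.card_Iic]
  have h2 := Finset.sum_range_succ' (fun i => i) N
  rw [Finset.sum_range_id, Nat.add_sub_cancel, add_zero] at h2
  rw [h1, vechDim, Fin.sum_univ_eq_sum_range (fun i => i + 1) N, ← h2, mul_comm]

lemma card_regIdx (N p : ℕ) : Fintype.card (RegIdx N p) = p * vechDim N + 1 := by
  rw [Fintype.card_option, Fintype.card_prod, Fintype.card_fin, card_vechIdx]

lemma one_le_vechDim {N : ℕ} (hN : 1 ≤ N) : 1 ≤ vechDim N := by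
  rw [← card_vechIdx]
  exact Fintype.card_pos_iff.2 ⟨⟨(⟨0, hN⟩, ⟨0, hN⟩), le_rfl⟩⟩

lemma logDim_pos {N p : ℕ} (hN : 1 ≤ N) (hp : 1 ≤ p) : 0 < logDim N p := by
  refine Real.log_pos ?_
  have := Nat.mul_le_mul hp (one_le_vechDim hN)
  exact_mod_cast (by omega : 1 < p * vechDim N + 1)

lemma exp_logDim (N p : ℕ) : Real.exp (logDim N p) = ((p * vechDim N + 1 : ℕ) : ℝ) :=
  Real.exp_log (by positivity)

lemma card_regIdx_prod_le {N p : ℕ} (hp : 1 ≤ p) :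
    ((Fintype.card (RegIdx N p × (RegIdx N p ⊕ VechIdx N)) : ℕ) : ℝ) ≤
      2 * Real.exp (2 * logDim N p) := by
  rw [two_mul (logDim N p), Real.exp_add, exp_logDim, Fintype.card_prod, Fintype.card_sum,
    card_regIdx, card_vechIdx]
  have h2 : vechDim N ≤ p * vechDim N + 1 := (Nat.le_mul_of_pos_left _ hp).trans (Nat.le_succ _)
  have h3 : (p * vechDim N + 1) * (p * vechDim N + 1 + vechDim N) ≤
      2 * ((p * vechDim N + 1) * (p * vechDim N + 1)) := by nlinarith
  exact_mod_cast h3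

lemma one_le_of_ncard_support_le {m n : Type*} [Fintype m] [Nonempty n] {B : Matrix m n ℝ} {s : ℕ}
    (hB : 0 < norm1Inf B) (hs : ∀ j, {i | B i j ≠ 0}.ncard ≤ s) : 1 ≤ s := by
  by_contra hc
  have hs0 : s = 0 := by omega
  have hz : ∀ j, ∑ i, |B i j| = 0 := fun j => by
    have h1 := hs j
    rw [hs0, Nat.le_zero, Set.ncard_eq_zero (Set.toFinite _)] at h1
    refine Finset.sum_eq_zero fun i _ => abs_eq_zero.2 ?_
    by_contra hne
    exact Set.eq_empty_iff_forall_notMem.1 h1 i hne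
  have : norm1Inf B = 0 := by rw [norm1Inf]; simp_rw [hz]; simp
  linarith

lemma Teff_pos {T : ℕ} (hT : 2 ≤ T) : 0 < Teff T := by
  have := half_lt_log hT
  have : (0 : ℝ) < Real.log T := by linarith
  unfold Teff
  positivity

/-- Expresses the rate through the quantity of which `tauScale` is a power, so that bias and
fluctuation can be compared as powers of one number. -/
lemma rate_eq {N p T : ℕ} {ε M : ℝ} (hN : 1 ≤ N) (hp : 1 ≤ p) (hT : 2 ≤ T) (hε : 0 < ε)
    (hM : 1 ≤ M) :
    rate N p T ε M = M * (M * Teff T / logDim N p) ^ (-(ε / (1 + ε))) := by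
  have hL := logDim_pos hN hp
  have hTe := Teff_pos hT
  have hM0 : 0 < M := by linarith
  have e : M ^ (1 / ε) * logDim N p / Teff T =
      M ^ ((1 + ε) / ε) * (M * Teff T / logDim N p)⁻¹ := by
    rw [add_div, div_self hε.ne', Real.rpow_add hM0, Real.rpow_one]
    field_simp
  rw [rate, e, Real.mul_rpow (by positivity) (by positivity), ← Real.rpow_mul hM0.le,
    Real.inv_rpow (by positivity), Real.rpow_neg (by positivity)]
  congr 1
  rw [div_mul_div_cancel₀ hε.ne', div_self (by linarith), Real.rpow_one]

end Scales

/-! ### Deviation of truncated sample moments. -/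

section UniformDeviation

variable {Ω : Type*} [MeasurableSpace Ω] {μ : Measure Ω} [IsProbabilityMeasure μ] {N : ℕ}
  {r : ℤ → Ω → Fin N → ℝ}

set_option maxHeartbeats 800000 in
/-- Uniform bound for the deviation of the sample mean of a truncated monomial from the population
mean of the monomial itself. -/
lemma measure_pathMonomial_deviation_le (hr : ∀ t, Measurable (r t)) {p G T : ℕ} (hG : 1 ≤ G)
    (hN : 1 ≤ N) (hp : 1 ≤ p) (hT : 2 ≤ T) {ζ C : ℝ} (hζ : 0 ≤ ζ) (hζG : ζ ^ G ≤ Real.exp (-2))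
    (hC : 0 ≤ C) (hα : ∀ l : ℕ, 1 ≤ l → alphaMixing μ r l ≤ C * ζ ^ l)
    {ε M : ℝ} (hε : 0 < ε) (hε1 : ε ≤ 1) (hM : 1 ≤ M)
    (hmom : ∀ t j, Integrable (fun ω => |r t ω j| ^ (4 + 4 * ε)) μ ∧
      ∫ ω, |r t ω j| ^ (4 + 4 * ε) ∂μ ≤ M)
    {τ τlo τhi κ : ℝ} (hτlo0 : 0 < τlo) (hτlo : τlo * tauScale N p T ε M ≤ τ)
    (hτhi : τ ≤ τhi * tauScale N p T ε M) {s : ℕ} (hs : 1 ≤ s)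
    (hκ : κ = 8 * τlo ^ (-(4 * ε)) + 12 * max 1 τhi ^ 4 * (2 + 6 * G + 2 * p) +
      (max 1 τhi ^ 4 + 5))
    {a : Fin 4 → Option (ℕ × Fin N)} (ha : ∀ k l i, a k = some (l, i) → l ≤ p) {γ : ℝ}
    (hγ : ∀ t, ∫ ω, pathMonomial (fun u => r u ω) t a ∂μ = γ) :
    μ.real {ω | κ * (s * rate N p T ε M) < |1 / (T : ℝ) * ∑ t : Fin T,
        pathMonomial (truncPath τ fun u => r u ω) ((t : ℕ) + 1) a - γ|} ≤
      2 * Real.exp (2 * C) * Real.exp (-(5 * (s * Real.log T * logDim N p))) := by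
  have hL := logDim_pos hN hp
  have hTe := Teff_pos hT
  have hlog := half_lt_log hT
  have hlog0 : 0 < Real.log T := by linarith
  have hT0 : (0 : ℝ) < T := by positivity
  have hM0 : 0 < M := by linarith
  have hs1 : (1 : ℝ) ≤ s := by exact_mod_cast hs
  rw [rate_eq hN hp hT hε hM]
  unfold tauScale at hτlo hτhi
  set L := logDim N p
  set Q := M * Teff T / L with hQ
  have hQ0 : 0 < Q := by positivity
  set B := max 1 τhi ^ 4 with hB
  have hB1 : 1 ≤ B := one_le_pow₀ (le_max_left _ _)
  have hτ : 0 < τ := lt_of_lt_of_le (by positivity) hτlo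
  have hτlo' : 0 ≤ τlo ^ (-(4 * ε)) := by positivity
  have hT1 : (1 / (T : ℝ)) * T = 1 := by field_simp
  -- For `Q < 1` the rate is at least `M`, while the sample and population means are bounded by `B`
  -- and `5 * M`; the event is empty thanks to the summand `B + 5` of `κ`. The other two summands
  -- serve the case `1 ≤ Q`, one for the bias and one for the fluctuation.
  rcases lt_or_ge Q 1 with hQ1 | hQ1
  · have hR : M ≤ s * (M * Q ^ (-(ε / (1 + ε)))) := by
      have h1 : 1 ≤ Q ^ (-(ε / (1 + ε))) :=
        Real.one_le_rpow_of_pos_of_le_one_of_nonpos hQ0 hQ1.le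
          (neg_nonpos.2 (by positivity))
      have h2 : M ≤ M * Q ^ (-(ε / (1 + ε))) := le_mul_of_one_le_right hM0.le h1
      nlinarith
    have hempty : {ω | κ * (s * (M * Q ^ (-(ε / (1 + ε))))) < |1 / (T : ℝ) * ∑ t : Fin T,
        pathMonomial (truncPath τ fun u => r u ω) ((t : ℕ) + 1) a - γ|} = ∅ := by
      refine Set.eq_empty_of_forall_notMem fun ω hω => ?_
      have h0 : Q ^ (1 / (4 + 4 * ε)) ≤ 1 := Real.rpow_le_one hQ0.le hQ1.le (by positivity)
      have h0' : 0 < Q ^ (1 / (4 + 4 * ε)) := by positivity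
      have h1 : τ ≤ max 1 τhi := by
        have : 0 < τhi := by by_contra hc; nlinarith
        refine le_trans ?_ (le_max_right _ _)
        nlinarith
      have h2 : |1 / (T : ℝ) * ∑ t : Fin T,
          pathMonomial (truncPath τ fun u => r u ω) ((t : ℕ) + 1) a| ≤ B := by
        rw [abs_mul, abs_of_pos (by positivity : 0 < 1 / (T : ℝ))]
        have : |∑ t : Fin T, pathMonomial (truncPath τ fun u => r u ω) ((t : ℕ) + 1) a| ≤ T * B := by
          refine (Finset.abs_sum_le_sum_abs _ _).trans ?_
          refine (Finset.sum_le_card_nsmul _ _ B fun t _ => ?_).trans_eq (by simp)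
          refine (abs_pathMonomial_trunc_le hτ.le _ _ a).trans ?_
          exact pow_le_pow_left₀ (by positivity) (max_le (le_max_left _ _) h1) 4
        calc _ ≤ 1 / (T : ℝ) * (T * B) := by gcongr
          _ = B := by rw [← mul_assoc, hT1, one_mul]
      have h3 : |γ| ≤ 5 * M := by
        rw [← hγ 0]; exact (pathMonomial_moments hr hε hmom hM 0 a hτ).2.1
      have h4 := (Set.mem_ofPred_eq ▸ hω : _ < _).trans_le (abs_sub _ _)
      have h5 : (B + 5) * M ≤ κ * (s * (M * Q ^ (-(ε / (1 + ε))))) := by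
        refine mul_le_mul ?_ hR hM0.le (by rw [hκ]; positivity)
        rw [hκ]
        have : 0 ≤ 12 * B * (2 + 6 * (G : ℝ) + 2 * p) := by positivity
        linarith
      nlinarith
    rw [hempty, measureReal_empty]
    positivity
  · set Z : ℤ → Ω → ℝ := fun t ω => pathMonomial (truncPath τ fun u => r u ω) t a with hZ
    set b := B * Q ^ (1 / (1 + ε)) with hb
    have hb0 : 0 < b := by positivity
    have hQpow : (Q ^ (1 / (4 + 4 * ε))) ^ 4 = Q ^ (1 / (1 + ε)) := by
      rw [← Real.rpow_natCast, ← Real.rpow_mul hQ0.le]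
      congr 1
      have : (1 : ℝ) + ε ≠ 0 := by positivity
      push_cast
      field_simp
    have hZb : ∀ t ω, |Z t ω| ≤ b := fun t ω => by
      refine (abs_pathMonomial_trunc_le hτ.le _ t a).trans ?_
      rw [hb, ← hQpow, hB, ← mul_pow]
      refine pow_le_pow_left₀ (by positivity) (max_le ?_ ?_) 4
      · have := Real.one_le_rpow hQ1 (show 0 ≤ 1 / (4 + 4 * ε) by positivity)
        exact one_le_mul_of_one_le_of_one_le (le_max_left _ _) this
      · exact hτhi.trans (mul_le_mul_of_nonneg_right (le_max_right _ _) (by positivity))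
    have hZp : ∀ t, Measurable[pastSigma r t] (Z t) := fun t =>
      (measurable_pathMonomial (fun k l i _ => measurable_pastSigma r (by omega)) τ).2
    have hZf : ∀ t, Measurable[futureSigma r (t - p)] (Z t) := fun t =>
      (measurable_pathMonomial (fun k l i hk => measurable_futureSigma r
        (by have := ha k l i hk; omega)) τ).2
    have hmo := fun t => pathMonomial_moments hr hε hmom hM t a hτ
    set Qc : ℝ := 2 + 6 * G + 2 * p with hQc
    have hQc0 : 0 < Qc := by positivity
    -- The tail exponent is then `6 * (s * log T * L)`. The variance term uses up one multiple, by
    -- `g3`, and five remain for the union bound.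
    set y := 6 * s * L * Real.log T ^ 2 * Qc with hy
    have hy0 : 0 ≤ y := by positivity
    have hdev := measure_abs_sum_sub_ge_le hr hG hT hζ hζG hC hα hZp hZf hb0 hZb hε1 hM0.le
      (fun t => (hmo t).2.2.1) (fun t => (hmo t).2.2.2.1) hy0
    have hMQ : T * M = L * Real.log T ^ 2 * Q := by
      rw [hQ, Teff]; field_simp
    have hTR : T * (M * Q ^ (-(ε / (1 + ε)))) = L * Real.log T ^ 2 * Q ^ (1 / (1 + ε)) := by
      rw [← mul_assoc, hMQ, mul_assoc, ← Real.rpow_one_add' hQ0.le]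
      · congr 2
        have : (1 : ℝ) + ε ≠ 0 := by positivity
        field_simp
        ring
      · have : (1 : ℝ) + ε ≠ 0 := by positivity
        field_simp
        norm_num
        exact this
    have hbias : 8 * M * τ ^ (-(4 * ε)) ≤
        8 * τlo ^ (-(4 * ε)) * (M * Q ^ (-(ε / (1 + ε)))) := by
      have h1 : τ ^ (-(4 * ε)) ≤ (τlo * Q ^ (1 / (4 + 4 * ε))) ^ (-(4 * ε)) :=
        Real.rpow_le_rpow_of_nonpos (by positivity) hτlo (by linarith)
      rw [Real.mul_rpow hτlo0.le (by positivity), ← Real.rpow_mul hQ0.le] at h1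
      have h2 : 1 / (4 + 4 * ε) * -(4 * ε) = -(ε / (1 + ε)) := by
        have : (1 : ℝ) + ε ≠ 0 := by positivity
        field_simp
      rw [h2] at h1
      calc 8 * M * τ ^ (-(4 * ε)) ≤ 8 * M * (τlo ^ (-(4 * ε)) * Q ^ (-(ε / (1 + ε)))) := by gcongr
        _ = _ := by ring
    have hsub : {ω | κ * (s * (M * Q ^ (-(ε / (1 + ε))))) < |1 / (T : ℝ) * ∑ t : Fin T,
        pathMonomial (truncPath τ fun u => r u ω) ((t : ℕ) + 1) a - γ|} ⊆
        {ω | 2 * b * y ≤ |∑ t ∈ Finset.Ioc (0 : ℤ) T, (Z t ω - ∫ ω', Z t ω' ∂μ)|} := by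
      intro ω hω
      rw [Set.mem_ofPred_eq] at hω ⊢
      rw [sum_Ioc_int_eq_sum_fin]
      set R := M * Q ^ (-(ε / (1 + ε))) with hR
      have hR0 : 0 < R := by positivity
      have e1 : ∑ t : Fin T, (Z ((t : ℕ) + 1) ω - γ) =
          T * (1 / (T : ℝ) * ∑ t : Fin T, Z ((t : ℕ) + 1) ω - γ) := by
        rw [Finset.sum_sub_distrib]
        simp only [Finset.sum_const, Finset.card_univ, Fintype.card_fin, nsmul_eq_mul]
        field_simp
      have e2 : T * (κ * (s * R)) ≤ |∑ t : Fin T, (Z ((t : ℕ) + 1) ω - γ)| := by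
        rw [e1, abs_mul, abs_of_pos hT0]
        exact mul_le_mul_of_nonneg_left hω.le hT0.le
      have e3 : |∑ t : Fin T, (∫ ω', Z ((t : ℕ) + 1) ω' ∂μ - γ)| ≤
          T * (8 * τlo ^ (-(4 * ε)) * R) := by
        refine (Finset.abs_sum_le_sum_abs _ _).trans ?_
        refine (Finset.sum_le_card_nsmul _ _ (8 * τlo ^ (-(4 * ε)) * R) fun t _ => ?_).trans_eq
          (by simp)
        rw [← hγ ((t : ℕ) + 1)]
        exact (hmo _).2.2.2.2.trans hbias
      have e4 : |∑ t : Fin T, (Z ((t : ℕ) + 1) ω - γ)| ≤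
          |∑ t : Fin T, (Z ((t : ℕ) + 1) ω - ∫ ω', Z ((t : ℕ) + 1) ω' ∂μ)| +
          |∑ t : Fin T, (∫ ω', Z ((t : ℕ) + 1) ω' ∂μ - γ)| := by
        refine le_trans (le_of_eq ?_) (abs_add_le _ _)
        rw [← Finset.sum_add_distrib]
        congr 1
        exact Finset.sum_congr rfl fun _ _ => by ring
      have e5 : 2 * b * y = 12 * B * Qc * s * (T * R) := by
        rw [hTR, hb, hy]; ring
      have e6 : 12 * B * Qc * s * (T * R) + T * (8 * τlo ^ (-(4 * ε)) * R) ≤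
          T * (κ * (s * R)) := by
        have f1 : T * (8 * τlo ^ (-(4 * ε)) * R) ≤ T * (8 * τlo ^ (-(4 * ε)) * (s * R)) := by
          gcongr; exact le_mul_of_one_le_left hR0.le hs1
        have f2 : 0 ≤ T * ((B + 5) * (s * R)) := by positivity
        rw [hκ]
        linarith
      linarith
    refine (measureReal_mono hsub).trans (hdev.trans ?_)
    rw [mul_assoc, ← Real.exp_add]
    refine mul_le_mul_of_nonneg_left (Real.exp_le_exp.2 ?_) (by norm_num)
    have g1 : y / (Qc * Real.log T) = 6 * (s * Real.log T * L) := by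
      rw [hy]; field_simp
    have g2 : M * b ^ (-(1 + ε)) ≤ M * Q⁻¹ := by
      have : b ^ (-(1 + ε)) = B ^ (-(1 + ε)) * Q⁻¹ := by
        rw [hb, Real.mul_rpow (by positivity) (by positivity), ← Real.rpow_mul hQ0.le,
          ← Real.rpow_neg_one]
        congr 2
        have : (1 : ℝ) + ε ≠ 0 := by positivity
        field_simp
      rw [this]
      have h1 : B ^ (-(1 + ε)) ≤ 1 := Real.rpow_le_one_of_one_le_of_nonpos hB1 (by linarith)
      have h2 : 0 ≤ Q⁻¹ := by positivity
      exact mul_le_mul_of_nonneg_left (mul_le_of_le_one_left h2 h1) hM0.le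
    have g3 : (T * (M * b ^ (-(1 + ε))) + C) / Real.log T ≤ s * Real.log T * L + 2 * C := by
      rw [div_le_iff₀ hlog0]
      have h1 : T * (M * b ^ (-(1 + ε))) ≤ L * Real.log T ^ 2 := by
        calc T * (M * b ^ (-(1 + ε))) ≤ T * (M * Q⁻¹) := by gcongr
          _ = L * Real.log T ^ 2 := by rw [← mul_assoc, hMQ]; field_simp
      have h2 : L * Real.log T ^ 2 ≤ s * (L * Real.log T ^ 2) :=
        le_mul_of_one_le_left (by positivity) hs1
      have h3 : C * 1 ≤ C * (2 * Real.log T) := mul_le_mul_of_nonneg_left (by linarith) hC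
      have h4 : (s * Real.log T * L + 2 * C) * Real.log T =
          s * (L * Real.log T ^ 2) + C * (2 * Real.log T) := by ring
      linarith
    rw [g1]
    linarith

end UniformDeviation

/-! ### Population moments and the Yule–Walker equations. -/

section PopulationMoments

variable {N p : ℕ}

/-- The two coordinates whose product is an entry of `x_t`. -/
def regCoords : RegIdx N p → Option (ℕ × Fin N) × Option (ℕ × Fin N)
  | none => (none, none)
  | some (i, q) => (some ((i : ℕ) + 1, q.1.1), some ((i : ℕ) + 1, q.1.2))

/-- The two coordinates whose product is an entry of `y_t`. -/
def respCoords (q : VechIdx N) : Option (ℕ × Fin N) × Option (ℕ × Fin N) :=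
  (some (0, q.1.1), some (0, q.1.2))

/-- The index of a product of two entries of `(x_t, y_t)`. -/
def quadCoords (c c' : Option (ℕ × Fin N) × Option (ℕ × Fin N)) : Fin 4 → Option (ℕ × Fin N) :=
  ![c.1, c.2, c'.1, c'.2]

lemma pathMonomial_quadCoords (path : ℤ → Fin N → ℝ) (t : ℤ)
    (c c' : Option (ℕ × Fin N) × Option (ℕ × Fin N)) :
    pathMonomial path t (quadCoords c c') = pathCoord path t c.1 * pathCoord path t c.2 *
      (pathCoord path t c'.1 * pathCoord path t c'.2) := by
  simp [pathMonomial, quadCoords, Fin.prod_univ_four, mul_assoc]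

lemma pathCoord_regCoords (path : ℤ → Fin N → ℝ) (t : ℤ) (a : RegIdx N p) :
    pathCoord path t (regCoords a).1 * pathCoord path t (regCoords a).2 = xVec p path t a := by
  rcases a with _ | ⟨i, q⟩
  · simp [regCoords, pathCoord, xVec]
  · simp [regCoords, pathCoord, xVec, yVec, vech, Matrix.vecMulVec_apply]

lemma pathCoord_respCoords (path : ℤ → Fin N → ℝ) (t : ℤ) (q : VechIdx N) :
    pathCoord path t (respCoords q).1 * pathCoord path t (respCoords q).2 = yVec path t q := by
  simp [respCoords, pathCoord, yVec, vech, Matrix.vecMulVec_apply]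

lemma lag_le_of_quadCoords_reg (a : RegIdx N p) (c : RegIdx N p ⊕ VechIdx N) (k : Fin 4) (l : ℕ)
    (i : Fin N) (h : quadCoords (regCoords a) (c.elim regCoords respCoords) k = some (l, i)) :
    l ≤ p := by
  have hreg : ∀ a : RegIdx N p, (∀ i, (regCoords a).1 = some (l, i) → l ≤ p) ∧
      ∀ i, (regCoords a).2 = some (l, i) → l ≤ p := by
    rintro (_ | ⟨j, q⟩)
    · simp [regCoords]
    · have := j.2
      simp only [regCoords, Option.some.injEq, Prod.mk.injEq]
      exact ⟨fun _ h => by omega, fun _ h => by omega⟩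
  have hresp : ∀ q : VechIdx N, (∀ i, (respCoords q).1 = some (l, i) → l ≤ p) ∧
      ∀ i, (respCoords q).2 = some (l, i) → l ≤ p := by
    intro q
    simp only [respCoords, Option.some.injEq, Prod.mk.injEq]
    exact ⟨fun _ h => by omega, fun _ h => by omega⟩
  have hc : (∀ i, (c.elim regCoords respCoords).1 = some (l, i) → l ≤ p) ∧
      ∀ i, (c.elim regCoords respCoords).2 = some (l, i) → l ≤ p := by
    rcases c with c | c
    exacts [hreg c, hresp c]
  fin_cases k
  exacts [(hreg a).1 i h, (hreg a).2 i h, hc.1 i h, hc.2 i h]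

variable {Ω : Type*} [MeasurableSpace Ω] {μ : Measure Ω} {r : ℤ → Ω → Fin N → ℝ}

lemma StrictlyStationary.integral_pathMonomial (h : StrictlyStationary μ r) (t : ℤ)
    (a : Fin 4 → Option (ℕ × Fin N)) :
    ∫ ω, pathMonomial (fun u => r u ω) t a ∂μ = ∫ ω, pathMonomial (fun u => r u ω) 1 a ∂μ := by
  have hm : Measurable fun path : ℤ → Fin N → ℝ => pathMonomial path 1 a :=
    (measurable_pathMonomial (r := fun (t : ℤ) (path : ℤ → Fin N → ℝ) => path t)
      (fun k l i _ => measurable_pi_apply _) 1).1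
  have h1 := ((h (t - 1)).comp hm).integral_eq
  refine Eq.trans ?_ h1
  refine integral_congr_ae (ae_of_all _ fun ω => ?_)
  simp only [Function.comp_apply, pathMonomial]
  refine Finset.prod_congr rfl fun k _ => ?_
  rcases a k with _ | ⟨l, i⟩
  · rfl
  · simp only [pathCoord]
    congr 2
    ring

variable [IsProbabilityMeasure μ] {K : Fin p → ℕ} {Om : Matrix (Fin N) (Fin N) ℝ}
  {A : (i : Fin p) → Fin (K i) → Matrix (Fin N) (Fin N) ℝ} {η : ℤ → Ω → Fin N → ℝ}

/-- The population means of the products of entries of `x_t` and `(x_t, y_t)`. -/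
def popMoment (Γ : Matrix (RegIdx N p) (RegIdx N p) ℝ) (Θ : Matrix (RegIdx N p) (VechIdx N) ℝ)
    (a : RegIdx N p) : RegIdx N p ⊕ VechIdx N → ℝ
  | .inl c => Γ a c
  | .inr q => ∑ c, Γ a c * Θ c q

/-- The Yule–Walker equations: entries of `x_t` are measurable with respect to the past, so `y_t`
may be replaced by its conditional mean `Θ*ᵀ x_t`. -/
lemma IsBEKKARCH.integral_pathMonomial (h : IsBEKKARCH μ Om A r η) (hst : StrictlyStationary μ r)
    {ε M : ℝ} (hε : 0 < ε) (hM : 1 ≤ M)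
    (hmom : ∀ t j, Integrable (fun ω => |r t ω j| ^ (4 + 4 * ε)) μ ∧
      ∫ ω, |r t ω j| ^ (4 + 4 * ε) ∂μ ≤ M) (t : ℤ) (a : RegIdx N p)
    (c : RegIdx N p ⊕ VechIdx N) :
    ∫ ω, pathMonomial (fun u => r u ω) t
      (quadCoords (regCoords a) (c.elim regCoords respCoords)) ∂μ =
      popMoment (gramMatrix μ p r) (thetaStar Om A) a c := by
  have hgram : ∀ t c, ∫ ω, xVec p (fun u => r u ω) t a * xVec p (fun u => r u ω) t c ∂μ =
      gramMatrix μ p r a c := fun t c => by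
    have := hst.integral_pathMonomial t (quadCoords (regCoords a) (regCoords c))
    simp_rw [pathMonomial_quadCoords, pathCoord_regCoords] at this
    exact this
  have hint : ∀ c, Integrable
      (fun ω => xVec p (fun u => r u ω) t a * xVec p (fun u => r u ω) t c) μ := fun c => by
    have := (pathMonomial_moments h.measurable_r hε hmom hM t
      (quadCoords (regCoords a) (regCoords c)) one_pos).1
    simp_rw [pathMonomial_quadCoords, pathCoord_regCoords] at this
    exact this
  rcases c with c | q
  · simp_rw [Sum.elim_inl, pathMonomial_quadCoords, pathCoord_regCoords]
    exact hgram t c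
  simp_rw [Sum.elim_inr, pathMonomial_quadCoords, pathCoord_regCoords, pathCoord_respCoords]
  have hV : ∀ ω (q : VechIdx N), xVec p (fun u => r u ω) t a *
      condCov Om A (fun u => r u ω) t q.1.1 q.1.2 = ∑ c, thetaStar Om A c q *
        (xVec p (fun u => r u ω) t a * xVec p (fun u => r u ω) t c) := fun ω q => by
    rw [condCov_apply_eq, Finset.mul_sum]
    exact Finset.sum_congr rfl fun _ _ => by ring
  have hxm : Measurable[pastSigma r (t - 1)] fun ω => xVec p (fun u => r u ω) t a := by
    rcases a with _ | ⟨i, q⟩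
    · exact measurable_const
    · have hm : ∀ k, Measurable[pastSigma r (t - 1)] fun ω => r (t - ((i : ℕ) + 1)) ω k := fun k =>
        (measurable_pi_apply k).comp (measurable_pastSigma r (by omega))
      exact (hm q.1.1).mul (hm q.1.2)
  have key := h.integral_mul_mul t hxm (fun i => by
    have := fun ω => hV ω ⟨(i, i), le_rfl⟩
    simp only at this
    simp_rw [this]
    exact integrable_finsetSum _ fun c _ => (hint c).const_mul _) q.1.1 q.1.2
  simp_rw [hV] at key
  rw [integral_finsetSum _ fun c _ => (hint c).const_mul _] at key
  simp_rw [integral_const_mul, hgram] at key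
  refine Eq.trans ?_ (key.trans ?_)
  · rfl
  · exact Finset.sum_congr rfl fun _ _ => mul_comm _ _

end PopulationMoments

/-! ### Reduction of the estimator to its columns. -/

section Estimator

variable {N : ℕ}

lemma normF_sq {m n : Type*} [Fintype m] [Fintype n] (B : Matrix m n ℝ) :
    normF B ^ 2 = ∑ i, ∑ j, B i j ^ 2 :=
  Real.sq_sqrt (Finset.sum_nonneg fun _ _ => Finset.sum_nonneg fun _ _ => sq_nonneg _)

/-- Every column of a regularized least squares estimate solves the regularized least squares
problem for that column. -/
lemma IsRegularizedLSE.column_le {p T : ℕ} {lam τ : ℝ} {path : ℤ → Fin N → ℝ}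
    {Θ : Matrix (RegIdx N p) (VechIdx N) ℝ} (h : IsRegularizedLSE p T lam τ path Θ)
    (q : VechIdx N) (θ : RegIdx N p → ℝ) :
    1 / (T : ℝ) / 2 * ∑ t : Fin T, (yVec (truncPath τ path) ((t : ℕ) + 1) q -
        ∑ i, xVec p (truncPath τ path) ((t : ℕ) + 1) i * Θ i q) ^ 2 + lam * ∑ i, |Θ i q| ≤
      1 / (T : ℝ) / 2 * ∑ t : Fin T, (yVec (truncPath τ path) ((t : ℕ) + 1) q -
        ∑ i, xVec p (truncPath τ path) ((t : ℕ) + 1) i * θ i) ^ 2 + lam * ∑ i, |θ i| := by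
  set φ : VechIdx N → (RegIdx N p → ℝ) → ℝ := fun q θ =>
    1 / (T : ℝ) / 2 * ∑ t : Fin T, (yVec (truncPath τ path) ((t : ℕ) + 1) q -
        ∑ i, xVec p (truncPath τ path) ((t : ℕ) + 1) i * θ i) ^ 2 + lam * ∑ i, |θ i| with hφ
  have hobj : ∀ Θ, objective p T lam τ path Θ = ∑ q, φ q fun i => Θ i q := fun Θ => by
    rw [objective, normF_sq, norm11,
      Finset.sum_comm, Finset.mul_sum, Finset.mul_sum, ← Finset.sum_add_distrib]
    refine Finset.sum_congr rfl fun q _ => ?_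
    simp only [hφ, Matrix.sub_apply, respMatrix, designMatrix, Matrix.mul_apply]
    congr 2
    rw [div_div, mul_comm]
  -- The competitor differs from `Θ` only in column `q`, so all other columns cancel.
  have h1 := h (Matrix.of fun i q' => if q' = q then θ i else Θ i q')
  rw [hobj, hobj] at h1
  simp only [Matrix.of_apply] at h1
  rw [← Finset.add_sum_erase _ _ (Finset.mem_univ q),
    ← Finset.add_sum_erase _ _ (Finset.mem_univ q)] at h1
  have h2 : ∑ q' ∈ Finset.univ.erase q, φ q' (fun i => if q' = q then θ i else Θ i q') =
      ∑ q' ∈ Finset.univ.erase q, φ q' fun i => Θ i q' :=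
    Finset.sum_congr rfl fun q' hq' => by simp only [if_neg (Finset.ne_of_mem_erase hq')]
  rw [h2] at h1
  simpa only [if_true] using le_of_add_le_add_right h1

/-- Column-wise error bound for a regularized least squares estimate, on the event that the sample
moments are close to the population moments. -/
lemma IsRegularizedLSE.column_error_le {p T : ℕ} {lam τ ρ B : ℝ} {path : ℤ → Fin N → ℝ} {s : ℕ}
    {Γ : Matrix (RegIdx N p) (RegIdx N p) ℝ} {Θ Θhat : Matrix (RegIdx N p) (VechIdx N) ℝ}
    (h : IsRegularizedLSE p T lam τ path Θhat) (hΓ : Γ.PosDef) (hlam : 0 < lam) (hρ : 0 ≤ ρ)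
    (hdev : ∀ a c, |1 / (T : ℝ) * ∑ t : Fin T, pathMonomial (truncPath τ path) ((t : ℕ) + 1)
      (quadCoords (regCoords a) (c.elim regCoords respCoords)) - popMoment Γ Θ a c| ≤ ρ)
    (hB : ∀ q, ∑ i, |Θ i q| ≤ B) (hρB : ρ * (1 + B) ≤ lam / 2)
    (hs : ∀ q, {i | Θ i q ≠ 0}.ncard ≤ s) (q : VechIdx N) :
    √(∑ i, (Θhat - Θ) i q ^ 2) ≤ 20 * (√s * lam * (lambdaMin Γ)⁻¹) := by
  obtain ⟨hmin0, hmin⟩ := lambdaMin_pos_and_le hΓ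
  refine lasso_error_le (1 / (T : ℝ)) (by positivity)
    (fun t : Fin T => xVec p (truncPath τ path) ((t : ℕ) + 1))
    (fun t : Fin T => yVec (truncPath τ path) ((t : ℕ) + 1) q)
    Γ (fun i => Θ i q) (fun i => Θhat i q) hlam hmin0 hρ (h.column_le q fun i => Θ i q)
    (fun i j => ?_) (fun i => ?_) (hB q) hρB (hs q) hmin
  · simpa only [Sum.elim_inl, pathMonomial_quadCoords, pathCoord_regCoords, popMoment]
      using hdev i (.inl j)
  · simpa only [Sum.elim_inr, pathMonomial_quadCoords, pathCoord_regCoords,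
      pathCoord_respCoords, popMoment] using hdev i (.inr q)

/-- There are at most `N ^ 2` columns, which is the source of the factor `N` in the Frobenius bound.
-/
lemma normF_le_of_column_le {p : ℕ} {B : Matrix (RegIdx N p) (VechIdx N) ℝ} {b : ℝ}
    (hb : 0 ≤ b) (h : ∀ q, √(∑ i, B i q ^ 2) ≤ b) : normF B ≤ N * b := by
  refine Real.sqrt_le_iff.2 ⟨by positivity, ?_⟩
  rw [Finset.sum_comm]
  have h1 : ∀ q, ∑ i, B i q ^ 2 ≤ b ^ 2 := fun q => (Real.sqrt_le_left hb).1 (h q)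
  refine (Finset.sum_le_card_nsmul _ _ (b ^ 2) fun q _ => h1 q).trans ?_
  rw [nsmul_eq_mul, mul_pow]
  refine mul_le_mul_of_nonneg_right ?_ (sq_nonneg b)
  have : Fintype.card (VechIdx N) ≤ N ^ 2 :=
    (Fintype.card_subtype_le _).trans_eq (by rw [Fintype.card_prod, Fintype.card_fin, sq])
  exact_mod_cast this

end Estimator

end BEKK

end

/-! ### The main theorem. -/

open BEKK in
theorem theorem1
    (p : ℕ) (_hp : 1 ≤ p) (ε : ℝ) (_hε : 0 < ε) (_hε1 : ε ≤ 1)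
    -- mixing constants: `α(ℓ) ≤ Cα ζ^ℓ` with `0 ≤ ζ ≤ ζbar < 1`
    (ζbar : ℝ) (_hζ : ζbar < 1) (Cα : ℝ)
    -- implied constants in `T ≳ log(pd+1)` and in `τ ≍ …`, lower bound for `‖Θ*‖_{1,∞}`
    (cT : ℝ) (_hcT : 0 < cT) (τlo τhi : ℝ) (_hτlo : 0 < τlo) (_hτhi : τlo ≤ τhi)
    (θ₀ : ℝ) (_hθ₀ : 0 < θ₀) :
    -- implied constants in `lam ≍ …`: the lower one is large enough, the upper one is arbitrary
    ∃ lamlo : ℝ, 0 < lamlo ∧ ∀ lamhi : ℝ, lamlo ≤ lamhi →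
    ∃ C₀ C₁ c₂ : ℝ, 0 < C₀ ∧ 0 < C₁ ∧ 0 < c₂ ∧
    ∀ {Ω : Type*} [MeasurableSpace Ω] (μ : Measure Ω) [IsProbabilityMeasure μ]
      (N : ℕ) (_hN : 1 ≤ N) (K : Fin p → ℕ) (Om : Matrix (Fin N) (Fin N) ℝ)
      (A : (i : Fin p) → Fin (K i) → Matrix (Fin N) (Fin N) ℝ)
      (r η : ℤ → Ω → Fin N → ℝ) (ζ M₄ M : ℝ) (s T : ℕ) (τ lam : ℝ)
      (Θhat : Ω → Matrix (RegIdx N p) (VechIdx N) ℝ),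
      IsBEKKARCH μ Om A r η →
      StrictlyStationary μ r →
      (∀ t j, Integrable (fun ω => |r t ω j| ^ (4 + 4 * ε)) μ ∧
        ∫ ω, |r t ω j| ^ (4 + 4 * ε) ∂μ ≤ M₄) →
      0 ≤ ζ → ζ ≤ ζbar → (∀ l : ℕ, 1 ≤ l → alphaMixing μ r l ≤ Cα * ζ ^ l) →
      M = max M₄ 1 →
      (gramMatrix μ p r).PosDef →
      (∀ j, {i | thetaStar Om A i j ≠ 0}.ncard ≤ s) →
      θ₀ ≤ norm1Inf (thetaStar Om A) →
      2 ≤ T → cT * logDim N p ≤ T →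
      τlo * tauScale N p T ε M ≤ τ → τ ≤ τhi * tauScale N p T ε M →
      lamlo * (s * norm1Inf (thetaStar Om A) * rate N p T ε M) ≤ lam →
      lam ≤ lamhi * (s * norm1Inf (thetaStar Om A) * rate N p T ε M) →
      (∀ᵐ ω ∂μ, IsRegularizedLSE p T lam τ (fun t => r t ω) (Θhat ω)) →
      ∃ G : Set Ω, MeasurableSet G ∧
        1 - C₁ * Real.exp (-(c₂ * s * Real.log T * logDim N p)) ≤ μ.real G ∧
        ∀ ω ∈ G,
          norm2Inf (Θhat ω - thetaStar Om A) ≤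
            C₀ * ((s : ℝ) ^ (3 / 2 : ℝ) * norm1Inf (thetaStar Om A)
              * (lambdaMin (gramMatrix μ p r))⁻¹ * rate N p T ε M) ∧
          normF (Θhat ω - thetaStar Om A) ≤
            C₀ * ((s : ℝ) ^ (3 / 2 : ℝ) * N * norm1Inf (thetaStar Om A)
              * (lambdaMin (gramMatrix μ p r))⁻¹ * rate N p T ε M) := by
  obtain ⟨G, hG, hζG⟩ := exists_pow_le_exp_neg_two _hζ
  set κ : ℝ := 8 * τlo ^ (-(4 * ε)) + 12 * max 1 τhi ^ 4 * (2 + 6 * G + 2 * p) +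
    (max 1 τhi ^ 4 + 5) with hκ
  have hκ0 : 0 < κ := by positivity
  -- No sign is assumed for `Cα`.
  set C := max Cα 0
  have hlo : 0 < 2 * κ * (1 + 1 / θ₀) := by positivity
  -- Since `θ₀ ≤ B`, one has `1 + B ≤ B * (1 + 1 / θ₀)`; hence the choice of `lamlo` gives `ρ * (1 +
  -- B) ≤ lam / 2`.
  refine ⟨2 * κ * (1 + 1 / θ₀), hlo, fun lamhi hlamhi =>
    ⟨20 * lamhi, 4 * Real.exp (2 * C), 1, by linarith, by positivity, one_pos, ?_⟩⟩
  intro Ω _ μ _ N hN K Om A r η ζ M₄ M s T τ lam Θhat hB hst hmom hζ0 hζ1 hα hM hΓ hs hθ hT _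
    hτlo hτhi hlamlo hlamhi' hLSE
  have hr := hB.measurable_r
  have hM1 : 1 ≤ M := hM ▸ le_max_right _ _
  have hmom' : ∀ t j, Integrable (fun ω => |r t ω j| ^ (4 + 4 * ε)) μ ∧
      ∫ ω, |r t ω j| ^ (4 + 4 * ε) ∂μ ≤ M := fun t j =>
    ⟨(hmom t j).1, (hmom t j).2.trans (hM ▸ le_max_left _ _)⟩
  have hα' : ∀ l : ℕ, 1 ≤ l → alphaMixing μ r l ≤ C * ζ ^ l := fun l hl =>
    (hα l hl).trans (mul_le_mul_of_nonneg_right (le_max_left _ _) (by positivity))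
  have : Nonempty (VechIdx N) := ⟨⟨(⟨0, hN⟩, ⟨0, hN⟩), le_rfl⟩⟩
  set Θ := thetaStar Om A with hΘ
  set Γ := gramMatrix μ p r
  set R := rate N p T ε M with hR
  set B := norm1Inf Θ with hBdef
  have hB0 : 0 < B := _hθ₀.trans_le hθ
  have hcol : ∀ q, ∑ i, |Θ i q| ≤ B := fun q =>
    le_ciSup (f := fun q => ∑ i, |Θ i q|) (Set.finite_range _).bddAbove q
  have hR0 : 0 < R := by
    rw [hR, rate_eq hN _hp hT _hε hM1]
    have := logDim_pos hN _hp
    have := Teff_pos hT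
    positivity
  have hs1 : 1 ≤ s := one_le_of_ncard_support_le hB0 hs
  have hs1' : (1 : ℝ) ≤ s := by exact_mod_cast hs1
  set ρ := κ * (s * R) with hρ
  have hρ0 : 0 < ρ := by positivity
  have hρlam : ρ * (1 + B) ≤ lam / 2 := by
    have h1 : 1 ≤ B / θ₀ := (one_le_div _hθ₀).2 hθ
    have h2 : 2 * κ * (1 + 1 / θ₀) * (s * B * R) = 2 * ρ * (B + B / θ₀) := by
      rw [hρ]; ring
    rw [h2] at hlamlo
    nlinarith
  have hlam : 0 < lam := lt_of_lt_of_le (by positivity) hlamlo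
  have hmin0 := (lambdaMin_pos_and_le hΓ).1
  set bad : RegIdx N p × (RegIdx N p ⊕ VechIdx N) → Set Ω := fun ac =>
    {ω | ρ < |1 / (T : ℝ) * ∑ t : Fin T, pathMonomial (truncPath τ fun u => r u ω) ((t : ℕ) + 1)
      (quadCoords (regCoords ac.1) (ac.2.elim regCoords respCoords)) -
        popMoment Γ Θ ac.1 ac.2|} with hbad
  have hbadle : ∀ ac, μ.real (bad ac) ≤
      2 * Real.exp (2 * C) * Real.exp (-(5 * (s * Real.log T * logDim N p))) := fun ac =>
    measure_pathMonomial_deviation_le hr hG hN _hp hT hζ0 (hζG ζ hζ0 hζ1) (le_max_right _ _) hα'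
      _hε _hε1 hM1 hmom' _hτlo hτlo hτhi hs1 hκ
      (lag_le_of_quadCoords_reg ac.1 ac.2)
      (fun t => hB.integral_pathMonomial hst _hε hM1 hmom' t ac.1 ac.2)
  set Bad : Set Ω := (⋃ ac, bad ac) ∪
    {ω | ¬ IsRegularizedLSE p T lam τ (fun t => r t ω) (Θhat ω)} with hBad
  have hBadle : μ.real Bad ≤ 4 * Real.exp (2 * C) *
      Real.exp (-(1 * s * Real.log T * logDim N p)) := by
    have h1 : μ.real Bad ≤ ∑ ac, μ.real (bad ac) := by
      refine (measureReal_union_le _ _).trans ?_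
      have : μ.real {ω | ¬ IsRegularizedLSE p T lam τ (fun t => r t ω) (Θhat ω)} = 0 := by
        rw [measureReal_def, ae_iff.1 hLSE]; rfl
      rw [this, add_zero]
      exact measureReal_iUnion_fintype_le _
    refine h1.trans ((Finset.sum_le_card_nsmul _ _ _ fun ac _ => hbadle ac).trans ?_)
    have hcard := card_regIdx_prod_le (N := N) _hp
    rw [Finset.card_univ, nsmul_eq_mul]
    have hL := logDim_pos hN _hp
    have hlog := half_lt_log hT
    calc _ ≤ 2 * Real.exp (2 * logDim N p) * (2 * Real.exp (2 * C) *
          Real.exp (-(5 * (s * Real.log T * logDim N p)))) := by gcongr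
      _ = 4 * Real.exp (2 * C) *
          Real.exp (2 * logDim N p + -(5 * (s * Real.log T * logDim N p))) := by
          rw [Real.exp_add]; ring
      _ ≤ _ := by
          gcongr
          -- This lets four of the five multiples of `s * log T * logDim` pay for the `2 * logDim`
          -- of the union bound.
          have h2 : 1 / 2 ≤ s * Real.log T := by nlinarith
          have h3 := mul_le_mul_of_nonneg_right h2 hL.le
          linarith
  -- `Θhat` is not assumed measurable, so `Bad` is enlarged to a measurable set of the same measure.
  refine ⟨(toMeasurable μ Bad)ᶜ, (measurableSet_toMeasurable _ _).compl, ?_, fun ω hω => ?_⟩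
  · rw [probReal_compl_eq_one_sub (measurableSet_toMeasurable _ _), measureReal_def,
      measure_toMeasurable, ← measureReal_def]
    linarith
  have hω' : ω ∉ Bad := fun h => hω (subset_toMeasurable _ _ h)
  simp only [hBad, Set.mem_union, Set.mem_iUnion, not_or, not_exists, Set.mem_ofPred_eq,
    not_not, hbad, not_lt] at hω'
  obtain ⟨hdev, hopt⟩ := hω'
  have hcolerr : ∀ q, √(∑ i, (Θhat ω - Θ) i q ^ 2) ≤
      20 * lamhi * ((s : ℝ) ^ (3 / 2 : ℝ) * B * (lambdaMin Γ)⁻¹ * R) := fun q => by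
    have h1 := hopt.column_error_le hΓ hlam hρ0.le (fun a c => hdev (a, c)) hcol hρlam hs q
    refine h1.trans ?_
    have h2 : (s : ℝ) ^ (3 / 2 : ℝ) = √s * s := by
      rw [Real.sqrt_eq_rpow, ← Real.rpow_add_one' (by positivity) (by norm_num)]
      norm_num
    calc 20 * (√s * lam * (lambdaMin Γ)⁻¹)
        ≤ 20 * (√s * (lamhi * (s * B * R)) * (lambdaMin Γ)⁻¹) := by gcongr
      _ = _ := by rw [h2]; ring
  have hlamhi0 : 0 < lamhi := hlo.trans_le hlamhi
  refine ⟨ciSup_le hcolerr, (normF_le_of_column_le (by positivity) hcolerr).trans_eq ?_⟩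
  ring
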